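/- Let $T>0$, $n,p,m\ge 0$ integers, $\phi:\mathbb R^n\times[0,T]\to\mathbb R$, $h:\mathbb R^n\times[0,T]\to\mathbb R^p$, $g:\mathbb R^n\times[0,T]\to\mathbb R^m$. Let $\Omega$ be the set of all $z\in L_\infty([0,T];\mathbb R^n)$ with $h(z(t),t)=0$ and $g(z(t),t)\ge 0$ (componentwise) for a.e. $t\in[0,T]$, and consider the problem of maximizing $P(z)=\int_0^T\phi(z(t),t)\,dt$ (Lebesgue integral) over $z\in\Omega$. Let $\bar z\in\Omega$ be a local optimal solution: $P(\bar z)$ is finite, and there is $\delta>0$ such that $P(\bar z)\ge P(z)$ for every $z\in\Omega$ with $\|z-\bar z\|_\infty\le\delta$ for which $t\mapsto\phi(z(t),t)$ is integrable. All gradients $\nabla$ and Hessians $\nabla^2$ are with respect to $z\in\mathbb{R}^n$, a bar denotes evaluation at $(\bar z(t),t)$, a prime denotes transposition, and $[h,g]$ is the stacked map into $\mathbb R^{p+m}$. Suppose that, for some $\epsilon>0$, with $B_t=\{z\in\mathbb R^n:\|z-\bar z(t)\|\le\epsilon\}$, the following hold. (H1) $\phi(\cdot,t)$ is twice continuously differentiable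 for every $t\in[0,T]$, $\phi(z,\cdot)$ is measurable for each $z$, and there is $K_\phi>0$ with $\|\nabla\bar\phi(t)\|\le K_\phi$ for a.e. $t$. (H5) $h(z,\cdot)$ and $g(z,\cdot)$ are measurable for each $z$, and for a.e. $t$ the maps $h(\cdot,t)$ and $g(\cdot,t)$ are continuously differentiable on $B_t$. (H6) There is an increasing function $\theta:(0,\infty)\to(0,\infty)$ with $\theta(s)\downarrow0$ as $s\downarrow0$ such that for a.e. $t$ and all distinct $\tilde z,z\in B_t$, $\|\nabla[h,g](\tilde z,t)-\nabla[h,g](z,t)\|\le\theta(\|\tilde z-z\|)$; and there is $K_1>0$ with $\|\nabla[h,g](\bar z(t),t)\|\le K_1$ for a.e. $t$. (H7) There is $K>0$ with $\det\{\Upsilon(t)\Upsilon'(t)\}\ge K$ for a.e. $t$, where $$\Upsilon(t)=\begin{bmatrix}\nabla\bar h(t)&0\\ \nabla\bar g(t)&\mathrm{diag}\{-2\sqrt{\bar g_j(t)}\}_{j=1}^m\end{bmatrix}.$$ Suppose also that $t\mapsto g(\bar z(t),t)$ is essentially bounded on $[0,T]$. Then there exists $(u,v)\in L_\infty([0,T];\mathbb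 R^p\times\mathbb R^m)$ such that for a.e. $t\in[0,T]$ $$\nabla\bar\phi(t)+\sum_{i=1}^pu_i(t)\nabla\bar h_i(t)+\sum_{j=1}^mv_j(t)\nabla\bar g_j(t)=0,\qquad v(t)\ge0,\qquad v_j(t)\bar g_j(t)=0\ \ (j=1,\dots,m).$$ Moreover, if in addition $h(\cdot,t)$ and $g(\cdot,t)$ are twice continuously differentiable on $B_t$ for a.e. $t$, then the same $(u,v)$ satisfies $$\int_0^T\gamma'(t)\Big\{\nabla^2\bar\phi(t)+\sum_{i=1}^pu_i(t)\nabla^2\bar h_i(t)+\sum_{j=1}^mv_j(t)\nabla^2\bar g_j(t)\Big\}\gamma(t)\,dt\le0$$ for all $\gamma\in\bar N$, where the integrand is measurable, the integral exists in $[-\infty,\infty]$, and $$\bar N=\{\gamma\in L_\infty([0,T];\mathbb R^n): \nabla\bar h(t)\gamma(t)=0 \text{ and } \nabla\bar g_j'(t)\gamma(t)=0 \text{ for every } j \text{ with } \bar g_j(t)=0,\ \text{for a.e. } t\}.$$ -/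

import Mathlib

open MeasureTheory Filter Topology
open scoped ENNReal

noncomputable section

/-- `ℝⁿ` with its Euclidean norm. -/
abbrev Vec (n : ℕ) : Type := EuclideanSpace ℝ (Fin n)

/-- Lebesgue measure on `[0,T]`. All "almost every `t ∈ [0,T]`" statements refer to it, and
`AEMeasurable` with respect to it is Lebesgue measurability on `[0,T]`. -/
abbrev timeMeasure (T : ℝ) : Measure ℝ := volume.restrict (Set.Icc 0 T)

/-- `f` is measurable and its Lebesgue integral exists in `[-∞, ∞]`, that is, the integrals of the
positive part and of the negative part of `f` are not both infinite. -/
def HasExtIntegral {α : Type*} [MeasurableSpace α] (f : α → ℝ) (μ : Measure α) : Prop :=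
  AEMeasurable f μ ∧
    ((∫⁻ x, ENNReal.ofReal (f x) ∂μ) ≠ ⊤ ∨ (∫⁻ x, ENNReal.ofReal (-f x) ∂μ) ≠ ⊤)

/-- The Lebesgue integral of `f` as an extended real number: the integral of the positive part minus
the integral of the negative part (meaningful when `HasExtIntegral f μ`). -/
def extIntegral {α : Type*} [MeasurableSpace α] (f : α → ℝ) (μ : Measure α) : EReal :=
  ((∫⁻ x, ENNReal.ofReal (f x) ∂μ : ℝ≥0∞) : EReal) -
    ((∫⁻ x, ENNReal.ofReal (-f x) ∂μ : ℝ≥0∞) : EReal)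

/-- The quadratic form `v' ∇²f(x) v` of the Hessian of `f` at `x`. -/
def hessianForm {n : ℕ} (f : Vec n → ℝ) (x v : Vec n) : ℝ :=
  fderiv ℝ (fun y => fderiv ℝ f y) x v v

/-- The Jacobian matrix at `x` of a map into `ℝᵏ`: row `i` is the gradient of component `i`. -/
def jacobianMatrix {n k : ℕ} (F : Vec n → Vec k) (x : Vec n) : Matrix (Fin k) (Fin n) ℝ :=
  Matrix.of fun i l => gradient (fun y => F y i) x l

section Problem

variable {n p m : ℕ} (T : ℝ) (φ : Vec n → ℝ → ℝ) (h : Vec n → ℝ → Vec p) (g : Vec n → ℝ → Vec m)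

/-- `z` belongs to the feasible set `Ω`: `z ∈ L^∞([0,T]; ℝⁿ)`, `h(z(t),t) = 0` and `g(z(t),t) ≥ 0`
(componentwise) for a.e. `t ∈ [0,T]`. -/
structure IsFeasible (z : ℝ → Vec n) : Prop where
  memLp : MemLp z ⊤ (timeMeasure T)
  eq_zero : ∀ᵐ t ∂timeMeasure T, h (z t) t = 0
  nonneg : ∀ᵐ t ∂timeMeasure T, ∀ j, 0 ≤ g (z t) t j

/-- The objective functional `P(z) = ∫₀ᵀ φ(z(t),t) dt`. -/
def objective (z : ℝ → Vec n) : ℝ := ∫ t, φ (z t) t ∂timeMeasure T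

/-- `P(z)` is a well-defined finite Lebesgue integral. -/
def ObjectiveFinite (z : ℝ → Vec n) : Prop :=
  Integrable (fun t => φ (z t) t) (timeMeasure T)

/-- `zbar` is a local optimal solution of: maximize `P` over `Ω`. The value `P(zbar)` is finite and is
at least `P(z)` for all `z ∈ Ω` in a closed `L^∞` ball around `zbar` at which `P` is defined. -/
structure IsLocalOptimal (zbar : ℝ → Vec n) : Prop where
  feasible : IsFeasible T h g zbar
  finite : ObjectiveFinite T φ zbar
  optimal : ∃ δ > 0, ∀ z : ℝ → Vec n, IsFeasible T h g z → ObjectiveFinite T φ z →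
    (∀ᵐ t ∂timeMeasure T, ‖z t - zbar t‖ ≤ δ) → objective T φ z ≤ objective T φ zbar

/-- Regularity of the objective: `φ(·,t)` is twice continuously differentiable for each `t ∈ [0,T]`,
`φ(z,·)` is measurable for each `z`, and `∇φ(zbar(t),t)` is essentially bounded. -/
structure ObjectiveRegular (zbar : ℝ → Vec n) : Prop where
  contDiff : ∀ t ∈ Set.Icc 0 T, ContDiff ℝ 2 (fun z => φ z t)
  measurable : ∀ z, AEMeasurable (fun t => φ z t) (timeMeasure T)
  gradient_bound : ∃ K > 0, ∀ᵐ t ∂timeMeasure T, ‖gradient (fun z => φ z t) (zbar t)‖ ≤ K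

/-- For a.e. `t`, `h(·,t)` and `g(·,t)` are `k` times continuously differentiable on the closed ball
`zbar(t) + ε B`. -/
def ConstraintsContDiff (k : ℕ) (ε : ℝ) (zbar : ℝ → Vec n) : Prop :=
  ∀ᵐ t ∂timeMeasure T,
    ContDiffOn ℝ k (fun z => h z t) (Metric.closedBall (zbar t) ε) ∧
    ContDiffOn ℝ k (fun z => g z t) (Metric.closedBall (zbar t) ε)

/-- `h(z,·)` and `g(z,·)` are measurable for each `z`, and `h(·,t)`, `g(·,t)` are continuously
differentiable on `zbar(t) + ε B` for a.e. `t`. -/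
structure ConstraintsRegular (ε : ℝ) (zbar : ℝ → Vec n) : Prop where
  measurable_h : ∀ z, AEMeasurable (fun t => h z t) (timeMeasure T)
  measurable_g : ∀ z, AEMeasurable (fun t => g z t) (timeMeasure T)
  contDiff : ConstraintsContDiff T h g 1 ε zbar

/-- The derivative of the stacked map `[h,g](·,t)` has on `zbar(t) + ε B` a modulus of continuity that
does not depend on `t`, and it is essentially bounded along `zbar`. The derivative is taken within the
ball, so that it also makes sense at the boundary points; inside it is the usual one. -/
structure ConstraintsUniform (ε : ℝ) (zbar : ℝ → Vec n) : Prop where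
  modulus : ∃ θ : ℝ → ℝ, (∀ s > 0, 0 < θ s) ∧ MonotoneOn θ (Set.Ioi 0) ∧
    Tendsto θ (𝓝[>] 0) (𝓝 0) ∧
    ∀ᵐ t ∂timeMeasure T,
      ∀ z ∈ Metric.closedBall (zbar t) ε, ∀ z' ∈ Metric.closedBall (zbar t) ε, z' ≠ z →
        ‖fderivWithin ℝ (fun y => (h y t, g y t)) (Metric.closedBall (zbar t) ε) z' -
          fderivWithin ℝ (fun y => (h y t, g y t)) (Metric.closedBall (zbar t) ε) z‖ ≤ θ ‖z' - z‖
  bound : ∃ K > 0, ∀ᵐ t ∂timeMeasure T, ‖fderiv ℝ (fun y => (h y t, g y t)) (zbar t)‖ ≤ K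

/-- The matrix `Υ(t) = [∇h, 0; ∇g, diag(-2 √g_j)]`, of size `(p+m) × (n+m)`, evaluated along
`zbar`. -/
def upsilon (zbar : ℝ → Vec n) (t : ℝ) : Matrix (Fin p ⊕ Fin m) (Fin n ⊕ Fin m) ℝ :=
  Matrix.fromBlocks (jacobianMatrix (fun z => h z t) (zbar t)) 0
    (jacobianMatrix (fun z => g z t) (zbar t))
    (Matrix.diagonal fun j => -2 * Real.sqrt (g (zbar t) t j))

/-- The uniform full rank condition: `det (Υ(t) Υ(t)') ≥ K > 0` for a.e. `t`. -/
def UniformFullRank (zbar : ℝ → Vec n) : Prop :=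
  ∃ K > 0, ∀ᵐ t ∂timeMeasure T, K ≤ (upsilon h g zbar t * (upsilon h g zbar t).transpose).det

/-- `γ` belongs to the critical cone: `γ ∈ L^∞([0,T]; ℝⁿ)` and, for a.e. `t`, `γ(t)` is orthogonal to
all the gradients of the components of `h` and to those of the active components of `g`. -/
structure IsCritical (zbar γ : ℝ → Vec n) : Prop where
  memLp : MemLp γ ⊤ (timeMeasure T)
  eq_constraints : ∀ᵐ t ∂timeMeasure T, ∀ i,
    inner ℝ (gradient (fun z => h z t i) (zbar t)) (γ t) = 0
  active_constraints : ∀ᵐ t ∂timeMeasure T, ∀ j, g (zbar t) t j = 0 →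
    inner ℝ (gradient (fun z => g z t j) (zbar t)) (γ t) = 0

/-- `γ(t)' {∇²φ + ∑ i, u_i(t) ∇²h_i + ∑ j, v_j(t) ∇²g_j} γ(t)` with the Hessians in the first variable
at `(zbar(t), t)`. -/
def lagrangianHessianForm (zbar : ℝ → Vec n) (u : ℝ → Vec p) (v : ℝ → Vec m) (γ : ℝ → Vec n)
    (t : ℝ) : ℝ :=
  hessianForm (fun z => φ z t) (zbar t) (γ t) +
    ∑ i, u t i * hessianForm (fun z => h z t i) (zbar t) (γ t) +
    ∑ j, v t j * hessianForm (fun z => g z t j) (zbar t) (γ t)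

end Problem

end

/-! The problem decouples in time. If, on a set of times of positive measure, a feasible point near
`zbar t` improved the integrand by at least some `η > 0`, a measurable choice of such points,
spliced into `zbar` on that set, would be an admissible competitor with larger objective. Hence for
almost every `t` the point `zbar t` is a local maximizer of a finite-dimensional program
(`IsLocalOptimal.ae_pointwise_max`). The measurable choice is a Kuratowski–Ryll-Nardzewski selection
from the zero set of a Carathéodory function on a compact ball.

For fixed `t`, put `A = upsilon h g zbar t` and `b = (∇φ, 0)`. Full rank and the implicit function
theorem give feasible curves (`exists_feasible_curve`), so `b ⬝ᵥ w ≤ 0` whenever `A w` vanishes in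
the equality rows and is nonnegative in the active rows. Thus `b` is orthogonal to the kernel of
`A`, and `l = -(A A')⁻¹ A b` solves `b + A' l = 0`. The slack rows of this equation give
complementarity, and testing it with `A w = e_j` gives the sign. The second-order inequality comes
from the Lagrangian along a curve that keeps active constraints at zero.

The multipliers form an explicit function of the data, hence are measurable. They are essentially
bounded because the data lie in a compact set on which `det (A A') ≥ K`. The second-order integrand
is nonpositive almost everywhere, so its integral exists and is nonpositive. -/

noncomputable section

/-! ### Measurable selection of zeros of Carathéodory functions -/

section Selection

variable {α E : Type*} [MeasurableSpace α] [MetricSpace E] {K : Set E} {F : E → α → ℝ}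

/-- The projection of the zero set of a Carathéodory function on a compact set is measurable. -/
theorem measurableSet_exists_eq_zero (hK : IsCompact K) (hm : ∀ y ∈ K, Measurable (F y))
    (hc : ∀ t, ContinuousOn (fun y => F y t) K) :
    MeasurableSet {t | ∃ y ∈ K, F y t = 0} := by
  obtain ⟨D, hDK, hDc, hKD⟩ := hK.isSeparable.exists_countable_dense_subset
  -- A countable dense subset suffices: continuity carries a zero to approximate zeros in `D`, and
  -- compactness makes the infimum of `|F|` attained, so approximate zeros force a zero.
  have key : {t | ∃ y ∈ K, F y t = 0} =
      ⋂ k : ℕ, ⋃ y ∈ D, {t | |F y t| < 1 / ((k : ℝ) + 1)} := by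
    ext t
    simp only [Set.mem_ofPred_eq, Set.mem_iInter, Set.mem_iUnion, exists_prop]
    constructor
    · rintro ⟨y, hy, h0⟩ k
      have h1 : ∀ᶠ x in 𝓝[K] y, |F x t| < 1 / ((k : ℝ) + 1) := by
        have := ((hc t y hy).abs).eventually_lt_const
          (u := 1 / ((k : ℝ) + 1)) (by simp [h0]; positivity)
        exact this
      have h2 : ∃ᶠ x in 𝓝[K] y, x ∈ D := by
        have := mem_closure_iff_frequently.1 (hKD hy)
        rw [frequently_nhdsWithin_iff]
        exact this.mono fun x hx => ⟨hx, hDK hx⟩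
      obtain ⟨x, hx, hx'⟩ := (h2.and_eventually h1).exists
      exact ⟨x, hx, hx'⟩
    · intro hk
      have hne : K.Nonempty := by
        obtain ⟨y, hy, -⟩ := hk 0
        exact ⟨y, hDK hy⟩
      obtain ⟨y, hy, hmin⟩ := hK.exists_isMinOn hne (hc t).abs
      refine ⟨y, hy, ?_⟩
      by_contra h0
      obtain ⟨k, hk'⟩ := exists_nat_one_div_lt (abs_pos.2 h0)
      obtain ⟨x, hx, hx'⟩ := hk k
      exact absurd (hmin (hDK hx)) (not_le.2 (hx'.trans hk'))
  rw [key]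
  refine MeasurableSet.iInter fun k => MeasurableSet.biUnion hDc fun y hy => ?_
  exact measurableSet_lt (hm y (hDK hy)).abs measurable_const

/-- Measurable selection of a zero, in a compact set, of a Carathéodory function. -/
theorem exists_measurable_zero_selection [SecondCountableTopology E] [CompleteSpace E]
    [MeasurableSpace E] [BorelSpace E]
    (hK : IsCompact K) (hm : ∀ y ∈ K, Measurable (F y))
    (hc : ∀ t, ContinuousOn (fun y => F y t) K) (hex : ∀ t, ∃ y ∈ K, F y t = 0) :
    ∃ σ : α → E, Measurable σ ∧ ∀ t, σ t ∈ K ∧ F (σ t) t = 0 := by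
  classical
  rcases isEmpty_or_nonempty α with hα | ⟨⟨t₀⟩⟩
  · exact ⟨fun t => (hα.false t).elim, measurable_of_empty _, fun t => (hα.false t).elim⟩
  have : Nonempty E := ⟨(hex t₀).choose⟩
  set S : α → Set E := fun t => {y ∈ K | F y t = 0} with hS
  have hSne : ∀ t, (S t).Nonempty := fun t => hex t
  have hSc : ∀ t, IsClosed (S t) := fun t =>
    ((hc t).preimage_isClosed_of_isClosed hK.isClosed (isClosed_singleton (x := (0 : ℝ))))
  have hSK : ∀ t, IsCompact (S t) := fun t => hK.of_isClosed_subset (hSc t) fun y hy => hy.1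
  -- The distance to the compact set `S t` is attained, so its sublevel sets are again projections
  -- of zero sets, over `K` cut by a closed ball.
  have hρ : ∀ x, Measurable fun t => Metric.infDist x (S t) := by
    intro x
    refine measurable_of_Iic fun r => ?_
    have : (fun t => Metric.infDist x (S t)) ⁻¹' Set.Iic r =
        {t | ∃ y ∈ K ∩ Metric.closedBall x r, F y t = 0} := by
      ext t
      simp only [Set.mem_preimage, Set.mem_Iic, Set.mem_ofPred_eq]
      constructor
      · intro h
        obtain ⟨y, hy, hd⟩ := (hSK t).exists_infDist_eq_dist (hSne t) x
        refine ⟨y, ⟨hy.1, ?_⟩, hy.2⟩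
        rw [Metric.mem_closedBall, dist_comm, ← hd]
        exact h
      · rintro ⟨y, ⟨hy, hyx⟩, h0⟩
        refine (Metric.infDist_le_dist_of_mem (show y ∈ S t from ⟨hy, h0⟩)).trans ?_
        rw [dist_comm]
        exact hyx
    rw [this]
    exact measurableSet_exists_eq_zero (hK.inter_right Metric.isClosed_closedBall)
      (fun y hy => hm y hy.1) (fun t => (hc t).mono Set.inter_subset_left)
  let d := TopologicalSpace.denseSeq E
  have hd : DenseRange d := TopologicalSpace.denseRange_denseSeq E
  -- Refinement of an approximate selection: take the first point of the dense sequence that is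
  -- `r'`-close to `S t` and `r`-close to the previous choice.
  have hstep : ∀ (r r' : ℝ), 0 < r → 0 < r' → ∀ y : α → E, Measurable y →
      (∀ t, Metric.infDist (y t) (S t) < r) →
      ∃ y' : α → E, Measurable y' ∧ (∀ t, Metric.infDist (y' t) (S t) < r') ∧
        ∀ t, dist (y t) (y' t) < r := by
    intro r r' hr hr' y hy hyr
    have hP : ∀ t, ∃ i, Metric.infDist (d i) (S t) < r' ∧ dist (y t) (d i) < r := by
      intro t
      obtain ⟨s, hs, hys⟩ := (Metric.infDist_lt_iff (hSne t)).1 (hyr t)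
      have ho : IsOpen (Metric.ball s r' ∩ Metric.ball (y t) r) :=
        Metric.isOpen_ball.inter Metric.isOpen_ball
      obtain ⟨i, hi⟩ := hd.exists_mem_open ho
        ⟨s, Metric.mem_ball_self hr', by rwa [Metric.mem_ball, dist_comm]⟩
      refine ⟨i, (Metric.infDist_le_dist_of_mem hs).trans_lt hi.1, ?_⟩
      rw [dist_comm]
      exact hi.2
    refine ⟨fun t => d (Nat.find (hP t)), ?_, fun t => (Nat.find_spec (hP t)).1,
      fun t => (Nat.find_spec (hP t)).2⟩
    refine Measurable.find (f := fun i _ => d i)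
      (p := fun i t => Metric.infDist (d i) (S t) < r' ∧ dist (y t) (d i) < r)
      (fun i => measurable_const) (fun i => ?_) hP
    exact (measurableSet_lt (hρ (d i)) measurable_const).inter
      (measurableSet_lt (hy.dist measurable_const) measurable_const)
  -- Summable radii, in the shape `C / 2 / 2 ^ k` used by `cauchySeq_of_le_geometric_two`, with `C =
  -- 1`.
  let r : ℕ → ℝ := fun k => (1 / 2) / 2 ^ k
  have hr : ∀ k, 0 < r k := fun k => by positivity
  let Y := fun k => {y : α → E // Measurable y ∧ ∀ t, Metric.infDist (y t) (S t) < r k}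
  have h0 : Nonempty (Y 0) := by
    have hP : ∀ t, ∃ i, Metric.infDist (d i) (S t) < r 0 := by
      intro t
      obtain ⟨s, hs⟩ := hSne t
      obtain ⟨i, hi⟩ := hd.exists_mem_open Metric.isOpen_ball ⟨s, Metric.mem_ball_self (hr 0)⟩
      exact ⟨i, (Metric.infDist_le_dist_of_mem hs).trans_lt hi⟩
    refine ⟨fun t => d (Nat.find (hP t)), ?_, fun t => Nat.find_spec (hP t)⟩
    exact Measurable.find (f := fun i _ => d i)
      (p := fun i t => Metric.infDist (d i) (S t) < r 0)
      (fun i => measurable_const) (fun i => measurableSet_lt (hρ (d i)) measurable_const) hP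
  have h1 : ∀ k (y : Y k), ∃ y' : Y (k + 1), ∀ t, dist (y.1 t) (y'.1 t) < r k := by
    intro k y
    obtain ⟨y', a, b, c⟩ := hstep (r k) (r (k + 1)) (hr k) (hr _) y.1 y.2.1 y.2.2
    exact ⟨⟨y', a, b⟩, c⟩
  choose next hnext using h1
  let y : ∀ k, Y k := fun k => Nat.rec h0.some next k
  have hy : ∀ k t, dist ((y k).1 t) ((y (k + 1)).1 t) ≤ 1 / 2 / 2 ^ k := fun k t =>
    (hnext k (y k) t).le
  have hlim : ∀ t, ∃ s, Tendsto (fun k => (y k).1 t) atTop (𝓝 s) := fun t =>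
    cauchySeq_tendsto_of_complete (cauchySeq_of_le_geometric_two (C := 1 / 2 * 2)
      (fun k => (hy k t).trans_eq (by ring)))
  choose σ hσ using hlim
  refine ⟨σ, measurable_of_tendsto_metrizable (fun k => (y k).2.1) (tendsto_pi_nhds.2 hσ),
    fun t => ?_⟩
  have hz : Metric.infDist (σ t) (S t) ≤ 0 := by
    refine le_of_tendsto_of_tendsto'
      ((Metric.continuous_infDist_pt (S t)).continuousAt.tendsto.comp (hσ t))
      (g := r) ?_ fun k => ((y k).2.2 t).le
    have : r = fun k : ℕ => 1 / 2 * (1 / 2 : ℝ) ^ k := by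
      funext k
      simp [r, div_eq_mul_inv]
    rw [this]
    have h2 := (tendsto_pow_atTop_nhds_zero_of_lt_one (r := (1 / 2 : ℝ)) (by norm_num)
      (by norm_num)).const_mul (1 / 2)
    rwa [mul_zero] at h2
  exact ((hSc t).mem_iff_infDist_zero (hSne t)).2 (le_antisymm hz Metric.infDist_nonneg)

end Selection

/-! ### Measurability of superpositions and of their derivatives -/

section Composition

variable {α E : Type*} [MeasurableSpace α] {μ : Measure α} {c : α → E} {f : E → α → ℝ} {ε : ℝ}

/-- Superposition of a Carathéodory function with a measurable function. -/
theorem aemeasurable_comp_of_continuousOn_closedBall [MetricSpace E] [SecondCountableTopology E]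
    [MeasurableSpace E] [BorelSpace E] (hm : ∀ y, AEMeasurable (f y) μ)
    (hcm : AEMeasurable c μ)
    (hc : ∀ᵐ t ∂μ, ContinuousOn (fun y => f y t) (Metric.closedBall (c t) ε))
    {z : α → E} (hz : AEMeasurable z μ) :
    AEMeasurable (fun t => if dist (z t) (c t) < ε then f (z t) t else 0) μ := by
  rcases isEmpty_or_nonempty α with hα | ⟨⟨t₀⟩⟩
  · exact (measurable_of_empty _).aemeasurable
  let y₀ := z t₀
  let s : ℕ → SimpleFunc α E :=
    SimpleFunc.approxOn (hz.mk z) hz.measurable_mk Set.univ y₀ (Set.mem_univ _)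
  have hs : ∀ t, Tendsto (fun k => s k t) atTop (𝓝 (hz.mk z t)) := fun t =>
    SimpleFunc.tendsto_approxOn _ _ (by simp)
  -- A simple function takes finitely many values, so only finitely many exceptional null sets
  -- occur.
  have h1 : ∀ k, AEMeasurable (fun t => f (s k t) t) μ := by
    intro k
    refine ⟨fun t => (hm (s k t)).mk _ t,
      SimpleFunc.measurable_bind (s k) (fun y t => (hm y).mk _ t)
        fun y => (hm y).measurable_mk, ?_⟩
    have h2 : ∀ᵐ t ∂μ, ∀ y ∈ (s k).range, f y t = (hm y).mk _ t :=
      (Finset.eventually_all _).2 fun y _ => (hm y).ae_eq_mk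
    filter_upwards [h2] with t ht
    exact ht _ (SimpleFunc.mem_range_self _ _)
  have hset : NullMeasurableSet {t | dist (z t) (c t) < ε} μ :=
    nullMeasurableSet_lt (hz.dist hcm) aemeasurable_const
  have h2 : ∀ k, AEMeasurable ({t | dist (z t) (c t) < ε}.indicator fun t => f (s k t) t) μ :=
    fun k => (h1 k).indicator₀ hset
  refine aemeasurable_of_tendsto_metrizable_ae atTop h2 ?_
  filter_upwards [hz.ae_eq_mk, hc] with t ht hct
  by_cases hd : dist (z t) (c t) < ε
  · have hmem : t ∈ {t | dist (z t) (c t) < ε} := hd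
    simp only [Set.indicator_of_mem hmem, if_pos hd]
    have hnhds : Metric.closedBall (c t) ε ∈ 𝓝 (z t) :=
      mem_of_superset (Metric.isOpen_ball.mem_nhds hd) Metric.ball_subset_closedBall
    have hlim := hs t
    rw [← ht] at hlim
    exact (hct.continuousAt hnhds).tendsto.comp hlim
  · have hmem : t ∉ {t | dist (z t) (c t) < ε} := hd
    simp only [Set.indicator_of_notMem hmem, if_neg hd]
    exact tendsto_const_nhds

variable [NormedAddCommGroup E] [NormedSpace ℝ E] [SecondCountableTopology E]
    [MeasurableSpace E] [BorelSpace E]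

/-- Measurability of directional derivatives along measurable functions. -/
theorem aemeasurable_fderiv_comp (hcm : AEMeasurable c μ)
    (hf : ∀ z : α → E, AEMeasurable z μ →
      AEMeasurable (fun t => if dist (z t) (c t) < ε then f (z t) t else 0) μ)
    (hd : ∀ᵐ t ∂μ, ∀ x ∈ Metric.ball (c t) ε, DifferentiableAt ℝ (fun y => f y t) x)
    {v : α → E} (hv : AEMeasurable v μ) {z : α → E} (hz : AEMeasurable z μ) :
    AEMeasurable (fun t => if dist (z t) (c t) < ε
      then fderiv ℝ (fun y => f y t) (z t) (v t) else 0) μ := by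
  have hset : NullMeasurableSet {t | dist (z t) (c t) < ε} μ :=
    nullMeasurableSet_lt (hz.dist hcm) aemeasurable_const
  -- Derivatives are limits of difference quotients with step `1 / k`. The truncation value `0` at
  -- `w k t` disappears in the limit, since `w k t` eventually enters the open ball.
  let w : ℕ → α → E := fun k t => z t + (k : ℝ)⁻¹ • v t
  have hw : ∀ k, AEMeasurable (w k) μ := fun k => hz.add (hv.const_smul _)
  have h2 : ∀ k : ℕ, AEMeasurable ({t | dist (z t) (c t) < ε}.indicator fun t => (k : ℝ) *
      ((if dist (w k t) (c t) < ε then f (w k t) t else 0) -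
        (if dist (z t) (c t) < ε then f (z t) t else 0))) μ :=
    fun k => (((hf _ (hw k)).sub (hf _ hz)).const_mul _).indicator₀ hset
  refine aemeasurable_of_tendsto_metrizable_ae atTop h2 ?_
  filter_upwards [hd] with t hdt
  by_cases hdist : dist (z t) (c t) < ε
  · have hmem : t ∈ {t | dist (z t) (c t) < ε} := hdist
    simp only [Set.indicator_of_mem hmem, if_pos hdist]
    have hlim := ((hdt (z t) hdist).hasFDerivAt.lim_real (v t)).comp
      tendsto_natCast_atTop_atTop
    have hwt : Tendsto (fun k => w k t) atTop (𝓝 (z t)) := by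
      have := (tendsto_inv_atTop_nhds_zero_nat (𝕜 := ℝ)).smul_const (v t)
      simpa [w] using this.const_add (z t)
    refine hlim.congr' ?_
    filter_upwards [hwt.eventually (Metric.isOpen_ball.mem_nhds hdist)] with k hk
    have hk' : dist (w k t) (c t) < ε := hk
    simp [if_pos hk', w]
  · have hmem : t ∉ {t | dist (z t) (c t) < ε} := hdist
    simp only [Set.indicator_of_notMem hmem, if_neg hdist]
    exact tendsto_const_nhds

/-- Measurability of second derivatives along measurable functions. -/
theorem aemeasurable_fderiv_fderiv_comp (hε : 0 < ε) (hcm : AEMeasurable c μ)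
    (hf : ∀ z : α → E, AEMeasurable z μ →
      AEMeasurable (fun t => if dist (z t) (c t) < ε then f (z t) t else 0) μ)
    (hd : ∀ᵐ t ∂μ, ∀ x ∈ Metric.ball (c t) ε, DifferentiableAt ℝ (fun y => f y t) x)
    (hd2 : ∀ᵐ t ∂μ, DifferentiableAt ℝ (fun x => fderiv ℝ (fun y => f y t) x) (c t))
    {v : α → E} (hv : AEMeasurable v μ) :
    AEMeasurable (fun t => fderiv ℝ (fun x => fderiv ℝ (fun y => f y t) x) (c t) (v t) (v t)) μ := by
  let w : ℕ → α → E := fun k t => c t + (k : ℝ)⁻¹ • v t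
  have hw : ∀ k, AEMeasurable (w k) μ := fun k => hcm.add (hv.const_smul _)
  have h2 : ∀ k : ℕ, AEMeasurable (fun t => (k : ℝ) *
      ((if dist (w k t) (c t) < ε then fderiv ℝ (fun y => f y t) (w k t) (v t) else 0) -
        (if dist (c t) (c t) < ε then fderiv ℝ (fun y => f y t) (c t) (v t) else 0))) μ :=
    fun k => (((aemeasurable_fderiv_comp hcm hf hd hv (hw k)).sub
      (aemeasurable_fderiv_comp hcm hf hd hv hcm))).const_mul _
  refine aemeasurable_of_tendsto_metrizable_ae atTop h2 ?_
  filter_upwards [hd2] with t hdt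
  have hlim := (hdt.hasFDerivAt.lim_real (v t)).comp tendsto_natCast_atTop_atTop
  have hlim' := ((ContinuousLinearMap.apply ℝ ℝ (v t)).continuous.tendsto _).comp hlim
  have hwt : Tendsto (fun k => w k t) atTop (𝓝 (c t)) := by
    have := (tendsto_inv_atTop_nhds_zero_nat (𝕜 := ℝ)).smul_const (v t)
    simpa [w] using this.const_add (c t)
  refine hlim'.congr' ?_
  filter_upwards [hwt.eventually (Metric.ball_mem_nhds _ hε)] with k hk
  have hk' : dist (w k t) (c t) < ε := hk
  simp only [if_pos hk', dist_self, if_pos hε]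
  simp [w]

end Composition

/-- Measurable selection of zeros of a function that is Carathéodory up to null sets. -/
theorem exists_aemeasurable_zero_selection {α E : Type*} [MeasurableSpace α] {μ : Measure α}
    [MetricSpace E] [SecondCountableTopology E] [CompleteSpace E] [MeasurableSpace E]
    [BorelSpace E] {K : Set E} {F : E → α → ℝ} (hK : IsCompact K) (hKne : K.Nonempty)
    (hm : ∀ y ∈ K, AEMeasurable (F y) μ)
    (hc : ∀ᵐ t ∂μ, ContinuousOn (fun y => F y t) K) :
    NullMeasurableSet {t | ∃ y ∈ K, F y t = 0} μ ∧
    ∃ σ : α → E, AEMeasurable σ μ ∧ (∀ t, σ t ∈ K) ∧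
      ∀ᵐ t ∂μ, (∃ y ∈ K, F y t = 0) → F (σ t) t = 0 := by
  classical
  set G : Set α := {t | ContinuousOn (fun y => F y t) K} with hG
  have hGm : NullMeasurableSet G μ :=
    nullMeasurableSet_univ.congr (eventuallyEq_univ.2 hc).symm
  -- Zeroing at the exceptional times gives continuity for every `t`. Measurability is meant in the
  -- completed σ-algebra.
  let F₁ : E → α → ℝ := fun y => G.indicator (F y)
  have hF₁m : ∀ y ∈ K,
      Measurable[NullMeasurableSpace.instMeasurableSpace (α := α) (μ := μ)] (F₁ y) := fun y hy =>
    ((hm y hy).indicator₀ hGm).nullMeasurable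
  have hF₁c : ∀ t, ContinuousOn (fun y => F₁ y t) K := by
    intro t
    by_cases ht : t ∈ G
    · simp only [F₁, Set.indicator_of_mem ht]
      exact ht
    · simp only [F₁, Set.indicator_of_notMem ht]
      exact continuousOn_const
  have hA₁ : NullMeasurableSet {t | ∃ y ∈ K, F₁ y t = 0} μ :=
    @measurableSet_exists_eq_zero α E
    (NullMeasurableSpace.instMeasurableSpace (α := α) (μ := μ)) _ K F₁ hK hF₁m hF₁c
  set A₁ : Set α := {t | ∃ y ∈ K, F₁ y t = 0}
  -- Zeroing off `A₁` makes every point of `K` a zero there, so a zero exists for every `t`, as the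
  -- selection theorem requires.
  let F₂ : E → α → ℝ := fun y => A₁.indicator (F₁ y)
  have hF₂m : ∀ y ∈ K,
      Measurable[NullMeasurableSpace.instMeasurableSpace (α := α) (μ := μ)] (F₂ y) := fun y hy =>
    have h1 : MeasurableSet[NullMeasurableSpace.instMeasurableSpace (α := α) (μ := μ)] A₁ := hA₁
    (hF₁m y hy).indicator h1
  have hF₂c : ∀ t, ContinuousOn (fun y => F₂ y t) K := by
    intro t
    by_cases ht : t ∈ A₁
    · simp only [F₂, Set.indicator_of_mem ht]
      exact hF₁c t
    · simp only [F₂, Set.indicator_of_notMem ht]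
      exact continuousOn_const
  obtain ⟨σ, hσm, hσ⟩ := @exists_measurable_zero_selection α E
    (NullMeasurableSpace.instMeasurableSpace (α := α) (μ := μ)) _ K F₂ _ _ _ _
    hK hF₂m hF₂c (fun t => by
      by_cases ht : t ∈ A₁
      · obtain ⟨y, hy, h0⟩ := id ht
        exact ⟨y, hy, by simp only [F₂, Set.indicator_of_mem ht, h0]⟩
      · exact ⟨hKne.some, hKne.some_mem, by simp only [F₂, Set.indicator_of_notMem ht]⟩)
  have hGt : ∀ t ∈ G, ∀ y, F₁ y t = F y t := fun t ht y => by
    simp only [F₁, Set.indicator_of_mem ht]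
  refine ⟨hA₁.congr ?_, σ, NullMeasurable.aemeasurable hσm, fun t => (hσ t).1, ?_⟩
  · refine eventuallyEq_set.2 ?_
    filter_upwards [hc] with t ht
    change (∃ y ∈ K, F₁ y t = 0) ↔ ∃ y ∈ K, F y t = 0
    simp only [hGt t ht]
  · filter_upwards [hc] with t ht hex
    have hA : t ∈ A₁ := by
      change ∃ y ∈ K, F₁ y t = 0
      simpa only [hGt t ht] using hex
    have := (hσ t).2
    simp only [F₂, Set.indicator_of_mem hA] at this
    rwa [hGt t ht] at this

/-! ### From local optimality in `L^∞` to pointwise local optimality -/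

section Pointwise

variable {n p m : ℕ} {T : ℝ} {φ : Vec n → ℝ → ℝ} {h : Vec n → ℝ → Vec p} {g : Vec n → ℝ → Vec m}
  {zbar : ℝ → Vec n} {ε : ℝ}

theorem ObjectiveRegular.aemeasurable_comp (hφ : ObjectiveRegular T φ zbar)
    (hzb : AEMeasurable zbar (timeMeasure T)) {z : ℝ → Vec n}
    (hz : AEMeasurable z (timeMeasure T)) :
    AEMeasurable (fun t => if dist (z t) (zbar t) < ε then φ (z t) t else 0) (timeMeasure T) := by
  refine aemeasurable_comp_of_continuousOn_closedBall hφ.measurable hzb ?_ hz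
  filter_upwards [ae_restrict_mem measurableSet_Icc] with t ht
  exact (hφ.contDiff t ht).continuous.continuousOn

theorem ConstraintsRegular.aemeasurable_comp_h (hreg : ConstraintsRegular T h g ε zbar)
    (hzb : AEMeasurable zbar (timeMeasure T)) (i : Fin p) {z : ℝ → Vec n}
    (hz : AEMeasurable z (timeMeasure T)) :
    AEMeasurable (fun t => if dist (z t) (zbar t) < ε then h (z t) t i else 0)
      (timeMeasure T) := by
  refine aemeasurable_comp_of_continuousOn_closedBall (f := fun z t => h z t i) (fun y => ?_)
    hzb ?_ hz
  · exact (EuclideanSpace.proj (𝕜 := ℝ) i).continuous.measurable.comp_aemeasurable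
      (hreg.measurable_h y)
  · filter_upwards [hreg.contDiff] with t ht
    exact (EuclideanSpace.proj (𝕜 := ℝ) i).continuous.comp_continuousOn ht.1.continuousOn

theorem ConstraintsRegular.aemeasurable_comp_g (hreg : ConstraintsRegular T h g ε zbar)
    (hzb : AEMeasurable zbar (timeMeasure T)) (j : Fin m) {z : ℝ → Vec n}
    (hz : AEMeasurable z (timeMeasure T)) :
    AEMeasurable (fun t => if dist (z t) (zbar t) < ε then g (z t) t j else 0)
      (timeMeasure T) := by
  refine aemeasurable_comp_of_continuousOn_closedBall (f := fun z t => g z t j) (fun y => ?_)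
    hzb ?_ hz
  · exact (EuclideanSpace.proj (𝕜 := ℝ) j).continuous.measurable.comp_aemeasurable
      (hreg.measurable_g y)
  · filter_upwards [hreg.contDiff] with t ht
    exact (EuclideanSpace.proj (𝕜 := ℝ) j).continuous.comp_continuousOn ht.2.continuousOn

/-- Measurability of a composition given in truncated form. -/
theorem aemeasurable_of_truncation {μ : Measure ℝ} {f : Vec n → ℝ → ℝ} {z : ℝ → Vec n}
    (H : AEMeasurable (fun t => if dist (z t) (zbar t) < ε then f (z t) t else 0) μ)
    (hz : ∀ t, dist (z t) (zbar t) < ε) : AEMeasurable (fun t => f (z t) t) μ := by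
  simpa only [hz, if_true] using H

/-- A nearby feasible perturbation cannot improve the integrand by a fixed amount on a set of
positive measure. -/
theorem IsLocalOptimal.ae_lt_add (hopt : IsLocalOptimal T φ h g zbar)
    (hφ : ObjectiveRegular T φ zbar) (hreg : ConstraintsRegular T h g ε zbar)
    {r : ℝ} (hr : 0 < r) (hrε : r < ε)
    (hrδ : ∀ z : ℝ → Vec n, IsFeasible T h g z → ObjectiveFinite T φ z →
      (∀ᵐ t ∂timeMeasure T, ‖z t - zbar t‖ ≤ r) → objective T φ z ≤ objective T φ zbar)
    {η : ℝ} (hη : 0 < η) :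
    ∀ᵐ t ∂timeMeasure T, ∀ y ∈ Metric.closedBall (0 : Vec n) r, h (zbar t + y) t = 0 →
      (∀ j, 0 ≤ g (zbar t + y) t j) → φ (zbar t + y) t < φ (zbar t) t + η := by
  classical
  have hzb : AEMeasurable zbar (timeMeasure T) := hopt.feasible.memLp.1.aemeasurable
  let K : Set (Vec n) := Metric.closedBall 0 r
  -- A sum of nonnegative penalties, zero exactly when `zbar t + y` is feasible and gains at least
  -- `η`.
  let F : Vec n → ℝ → ℝ := fun y t =>
    ∑ i, |h (zbar t + y) t i| + ∑ j, max (-g (zbar t + y) t j) 0 +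
      max (φ (zbar t) t + η - φ (zbar t + y) t) 0
  have hF0 : ∀ y t, F y t = 0 ↔ h (zbar t + y) t = 0 ∧ (∀ j, 0 ≤ g (zbar t + y) t j) ∧
      φ (zbar t) t + η ≤ φ (zbar t + y) t := by
    intro y t
    have a1 : 0 ≤ ∑ i, |h (zbar t + y) t i| := Finset.sum_nonneg fun i _ => abs_nonneg _
    have a2 : 0 ≤ ∑ j, max (-g (zbar t + y) t j) 0 :=
      Finset.sum_nonneg fun i _ => le_max_right _ _
    have a3 : 0 ≤ max (φ (zbar t) t + η - φ (zbar t + y) t) 0 := le_max_right _ _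
    rw [show F y t = ∑ i, |h (zbar t + y) t i| + ∑ j, max (-g (zbar t + y) t j) 0 +
      max (φ (zbar t) t + η - φ (zbar t + y) t) 0 from rfl,
      add_eq_zero_iff_of_nonneg (add_nonneg a1 a2) a3, add_eq_zero_iff_of_nonneg a1 a2,
      Finset.sum_eq_zero_iff_of_nonneg (fun i _ => abs_nonneg _),
      Finset.sum_eq_zero_iff_of_nonneg (fun i _ => le_max_right _ _), and_assoc]
    refine and_congr ?_ (and_congr ?_ ?_)
    · constructor
      · intro H
        ext i
        simpa using H i (Finset.mem_univ _)
      · intro H i _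
        simp [H]
    · simp
    · simp
  have hball : ∀ z : ℝ → Vec n, (∀ t, z t ∈ K) → ∀ t, dist (zbar t + z t) (zbar t) < ε := by
    intro z hz t
    have : ‖z t‖ ≤ r := mem_closedBall_zero_iff.1 (hz t)
    simpa using this.trans_lt hrε
  have hφm : ∀ z : ℝ → Vec n, AEMeasurable z (timeMeasure T) → (∀ t, z t ∈ K) →
      AEMeasurable (fun t => φ (zbar t + z t) t) (timeMeasure T) := fun z hz hzK =>
    aemeasurable_of_truncation (z := fun t => zbar t + z t)
      (hφ.aemeasurable_comp (ε := ε) hzb (hzb.add hz)) (hball z hzK)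
  have hφb : AEMeasurable (fun t => φ (zbar t) t) (timeMeasure T) := by
    simpa using hφm (fun _ => 0) aemeasurable_const (fun t => Metric.mem_closedBall_self hr.le)
  have hFm : ∀ y ∈ K, AEMeasurable (F y) (timeMeasure T) := by
    intro y hy
    have hym : AEMeasurable (fun t => zbar t + y) (timeMeasure T) := hzb.add_const y
    have hyb := hball (fun _ => y) (fun _ => hy)
    refine ((Finset.aemeasurable_fun_sum _ fun i _ => ?_).add
      (Finset.aemeasurable_fun_sum _ fun j _ => ?_)).add ?_
    · exact (aemeasurable_of_truncation (f := fun z t => h z t i)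
        (hreg.aemeasurable_comp_h hzb i hym) hyb).abs
    · exact (aemeasurable_of_truncation (f := fun z t => g z t j)
        (hreg.aemeasurable_comp_g hzb j hym) hyb).neg.max aemeasurable_const
    · exact ((hφb.add_const η).sub (hφm (fun _ => y) aemeasurable_const fun _ => hy)).max
        aemeasurable_const
  have hFc : ∀ᵐ t ∂timeMeasure T, ContinuousOn (fun y => F y t) K := by
    filter_upwards [hreg.contDiff, ae_restrict_mem measurableSet_Icc] with t ht htT
    have hmaps : Set.MapsTo (fun y => zbar t + y) K (Metric.closedBall (zbar t) ε) := by
      intro y hy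
      have : ‖y‖ ≤ r := mem_closedBall_zero_iff.1 hy
      simpa using this.trans hrε.le
    have hcont : ContinuousOn (fun y => zbar t + y) K := by fun_prop
    refine ((continuousOn_finsetSum _ fun i _ => ?_).add
      (continuousOn_finsetSum _ fun j _ => ?_)).add ?_
    · exact ((EuclideanSpace.proj (𝕜 := ℝ) i).continuous.comp_continuousOn
        (ht.1.continuousOn.comp hcont hmaps)).abs
    · exact ((EuclideanSpace.proj (𝕜 := ℝ) j).continuous.comp_continuousOn
        (ht.2.continuousOn.comp hcont hmaps)).neg.sup continuousOn_const
    · exact (continuousOn_const.sub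
        ((hφ.contDiff t htT).continuous.comp_continuousOn hcont)).sup continuousOn_const
  obtain ⟨hA, σ, hσm, hσK, hσ⟩ := exists_aemeasurable_zero_selection (isCompact_closedBall 0 r)
    ⟨0, Metric.mem_closedBall_self hr.le⟩ hFm hFc
  set A : Set ℝ := {t | ∃ y ∈ Metric.closedBall (0 : Vec n) r, F y t = 0}
  suffices hA0 : timeMeasure T A = 0 by
    have : ∀ᵐ t ∂timeMeasure T, t ∉ A := measure_eq_zero_iff_ae_notMem.1 hA0
    filter_upwards [this] with t ht y hy h0 hg
    by_contra hlt
    exact ht ⟨y, hy, (hF0 y t).2 ⟨h0, hg, not_lt.1 hlt⟩⟩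
  by_contra hne
  let D : ℝ → ℝ := fun t => φ (zbar t + σ t) t - φ (zbar t) t
  have hD : AEMeasurable D (timeMeasure T) := (hφm σ hσm hσK).sub hφb
  -- Bounding the gain keeps the competitor's objective finite; countably many levels `N` cover `A`,
  -- so one has positive measure.
  obtain ⟨N, hN⟩ : ∃ N : ℕ, timeMeasure T (A ∩ {t | |D t| ≤ N}) ≠ 0 := by
    by_contra! hall
    refine hne (measure_mono_null ?_ (measure_iUnion_null hall))
    intro t ht
    obtain ⟨N, hN⟩ := exists_nat_ge |D t|
    exact Set.mem_iUnion.2 ⟨N, ht, hN⟩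
  set B : Set ℝ := A ∩ {t | |D t| ≤ N} with hB
  have hBm : NullMeasurableSet B (timeMeasure T) :=
    hA.inter (nullMeasurableSet_le hD.abs aemeasurable_const)
  let z : ℝ → Vec n := fun t => zbar t + B.indicator σ t
  have hzB : ∀ t ∈ B, z t = zbar t + σ t := fun t ht => by
    simp only [z, Set.indicator_of_mem ht]
  have hzBc : ∀ t ∉ B, z t = zbar t := fun t ht => by
    simp only [z, Set.indicator_of_notMem ht, add_zero]
  have hind : ∀ t, ‖B.indicator σ t‖ ≤ r := by
    intro t
    by_cases ht : t ∈ B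
    · rw [Set.indicator_of_mem ht]
      exact mem_closedBall_zero_iff.1 (hσK t)
    · rw [Set.indicator_of_notMem ht, norm_zero]
      exact hr.le
  have hσB : ∀ᵐ t ∂timeMeasure T, t ∈ B → F (σ t) t = 0 := by
    filter_upwards [hσ] with t ht htB
    exact ht htB.1
  have hfeas : IsFeasible T h g z := by
    refine ⟨hopt.feasible.memLp.add ?_, ?_, ?_⟩
    · exact memLp_top_of_bound (hσm.indicator₀ hBm).aestronglyMeasurable r
        (Eventually.of_forall hind)
    · filter_upwards [hσB, hopt.feasible.eq_zero] with t ht ht0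
      by_cases htB : t ∈ B
      · rw [hzB t htB]
        exact ((hF0 _ _).1 (ht htB)).1
      · rw [hzBc t htB]
        exact ht0
    · filter_upwards [hσB, hopt.feasible.nonneg] with t ht ht0
      by_cases htB : t ∈ B
      · rw [hzB t htB]
        exact ((hF0 _ _).1 (ht htB)).2.1
      · rw [hzBc t htB]
        exact ht0
  have hsum : (fun t => φ (z t) t) = fun t => φ (zbar t) t + B.indicator D t := by
    funext t
    by_cases htB : t ∈ B
    · rw [hzB t htB, Set.indicator_of_mem htB]
      simp only [D]
      ring
    · rw [hzBc t htB, Set.indicator_of_notMem htB, add_zero]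
  have hint : Integrable (B.indicator D) (timeMeasure T) := by
    refine Integrable.of_bound (hD.indicator₀ hBm).aestronglyMeasurable N
      (Eventually.of_forall fun t => ?_)
    by_cases htB : t ∈ B
    · rw [Set.indicator_of_mem htB]
      exact htB.2
    · rw [Set.indicator_of_notMem htB, norm_zero]
      positivity
  have hfin : ObjectiveFinite T φ z := by
    unfold ObjectiveFinite
    rw [hsum]
    exact hopt.finite.add hint
  have hle := hrδ z hfeas hfin (Eventually.of_forall fun t => by
    simpa only [z, add_sub_cancel_left] using hind t)
  have hle' : ∫ t, B.indicator D t ∂timeMeasure T ≤ 0 := by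
    unfold objective at hle
    rw [hsum, integral_add hopt.finite hint] at hle
    linarith
  have hge : ∫ t, B.indicator (fun _ => η) t ∂timeMeasure T ≤
      ∫ t, B.indicator D t ∂timeMeasure T := by
    refine integral_mono_ae ((integrable_const η).indicator₀ hBm) hint ?_
    filter_upwards [hσB] with t ht
    by_cases htB : t ∈ B
    · simp only [Set.indicator_of_mem htB, D]
      linarith [((hF0 _ _).1 (ht htB)).2.2]
    · simp only [Set.indicator_of_notMem htB, le_refl]
  rw [integral_indicator₀ hBm, setIntegral_const, smul_eq_mul] at hge
  have hpos : 0 < (timeMeasure T).real B := ENNReal.toReal_pos hN (measure_ne_top _ _)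
  nlinarith [mul_pos hpos hη]

/-- A local optimal solution is, at almost every time, a local maximizer of the integrand among
the feasible points. -/
theorem IsLocalOptimal.ae_pointwise_max (hopt : IsLocalOptimal T φ h g zbar)
    (hφ : ObjectiveRegular T φ zbar) (hε : 0 < ε) (hreg : ConstraintsRegular T h g ε zbar) :
    ∀ᵐ t ∂timeMeasure T, ∀ᶠ y in 𝓝 (zbar t), h y t = 0 → (∀ j, 0 ≤ g y t j) →
      φ y t ≤ φ (zbar t) t := by
  obtain ⟨δ, hδ, hopt'⟩ := hopt.optimal
  -- Halving `ε` keeps perturbed points in the open ball, where truncated compositions agree with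
  -- the true ones.
  have hr : 0 < min δ (ε / 2) := lt_min hδ (half_pos hε)
  -- The gains `1 / (k + 1)` leave only countably many null sets to discard.
  have hall : ∀ k : ℕ, _ := fun k => hopt.ae_lt_add hφ hreg hr
    ((min_le_right _ _).trans_lt (half_lt_self hε))
    (fun z hz hz' hzr => hopt' z hz hz' (hzr.mono fun t ht => ht.trans (min_le_left _ _)))
    (η := 1 / ((k : ℝ) + 1)) (by positivity)
  filter_upwards [ae_all_iff.2 hall] with t ht
  filter_upwards [Metric.closedBall_mem_nhds _ hr] with y hy h0 hg
  refine le_of_forall_pos_lt_add fun η hη => ?_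
  obtain ⟨k, hk⟩ := exists_nat_one_div_lt hη
  have := ht k (y - zbar t) (by simpa [dist_eq_norm] using hy) (by simpa using h0)
    (by simpa using hg)
  rw [add_sub_cancel] at this
  linarith

end Pointwise

/-! ### Curves in level sets and necessary conditions along them -/

section Curves

variable {E : Type*} [NormedAddCommGroup E] [NormedSpace ℝ E]

/-- Every vector of the kernel of a surjective derivative is tangent to a curve in the level set. -/
theorem HasStrictFDerivAt.exists_curve [CompleteSpace E] {F : Type*} [NormedAddCommGroup F]
    [NormedSpace ℝ F] [FiniteDimensional ℝ F] {f : E → F} {f' : E →L[ℝ] F} {a : E}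
    (hf : HasStrictFDerivAt f f' a) (hsurj : Function.Surjective f') {x : E} (hx : f' x = 0) :
    ∃ c : ℝ → E, c 0 = a ∧ HasDerivAt c x 0 ∧ ∀ᶠ s in 𝓝 0, f (c s) = f a := by
  have hr : f'.range = ⊤ := LinearMap.range_eq_top.2 hsurj
  let k : f'.ker := ⟨x, hx⟩
  have hk : HasDerivAt (fun s : ℝ => s • k) k 0 := by
    simpa using (hasDerivAt_id (0 : ℝ)).smul_const k
  -- The implicit function parametrizes the level set by the kernel, with derivative at `0` the
  -- inclusion; the curve is the image of the line spanned by `x`.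
  refine ⟨fun s => hf.implicitFunction f f' hr (f a) (s • k), by simp, ?_, ?_⟩
  · have h1 := (hf.to_implicitFunction hr).hasFDerivAt
    rw [← zero_smul ℝ k] at h1
    exact h1.comp_hasDerivAt (0 : ℝ) hk
  · have h1 := hf.map_implicitFunction_eq hr
    have h2 : Tendsto (fun s : ℝ => (f a, s • k)) (𝓝 0) (𝓝 (f a, 0)) := by
      refine tendsto_const_nhds.prodMk_nhds ?_
      simpa using hk.continuousAt.tendsto
    exact h2.eventually h1

/-- First-order necessary condition along a curve. -/
theorem HasFDerivAt.apply_nonpos_of_curve {f : E → ℝ} {f' : E →L[ℝ] ℝ} {a w : E}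
    (hf : HasFDerivAt f f' a) {z : ℝ → E} (hz0 : z 0 = a) (hz : HasDerivAt z w 0)
    (hle : ∀ᶠ s in 𝓝[>] 0, f (z s) ≤ f a) : f' w ≤ 0 := by
  subst hz0
  have h1 : HasDerivAt (f ∘ z) (f' w) 0 := hf.comp_hasDerivAt (0 : ℝ) hz
  refine le_of_tendsto h1.tendsto_slope_zero_right ?_
  filter_upwards [hle, self_mem_nhdsWithin] with s hs hpos
  have hpos' : (0 : ℝ) < s := hpos
  simp only [zero_add, Function.comp_apply, smul_eq_mul]
  exact mul_nonpos_of_nonneg_of_nonpos (inv_nonneg.2 hpos'.le) (sub_nonpos.2 hs)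

/-- Second-order necessary condition along a curve starting at a critical point. -/
theorem HasFDerivAt.apply_apply_nonpos_of_curve {f : E → ℝ} {f' : E → E →L[ℝ] ℝ}
    {B : E →L[ℝ] E →L[ℝ] ℝ} {a w : E}
    (hf : ∀ᶠ x in 𝓝 a, HasFDerivAt f (f' x) x) (hf' : HasFDerivAt f' B a) (ha : f' a = 0)
    {z : ℝ → E} (hz0 : z 0 = a) (hz : HasDerivAt z w 0)
    (hle : ∀ᶠ s in 𝓝[>] 0, f (z s) ≤ f a) : B w w ≤ 0 := by
  subst hz0
  have hq : Tendsto (fun s : ℝ => s⁻¹ • (z s - z 0)) (𝓝[>] 0) (𝓝 w) := by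
    simpa using hz.tendsto_slope_zero_right
  have hzt : Tendsto z (𝓝[>] 0) (𝓝 (z 0)) := hz.continuousAt.tendsto.mono_left nhdsWithin_le_nhds
  -- The curve has only a first derivative at `0`, so `f ∘ z` is not expanded to second order.
  -- Instead the mean value theorem on the chord `Δ` gives `f' (z 0 + θ • Δ) Δ ≤ 0`, and since `f'`
  -- vanishes at `z 0` this number is within `η θ ‖Δ‖²` of `θ B Δ Δ`. Division by `θ` and rescaling
  -- by `s⁻¹` conclude.
  have key : ∀ η > 0, B w w ≤ η * ‖w‖ ^ 2 := by
    intro η hη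
    have hlo := (hasFDerivAt_iff_isLittleO.1 hf').def hη
    obtain ⟨ρ, hρ, hball⟩ := Metric.eventually_nhds_iff_ball.1 (hf.and hlo)
    have h1 : Tendsto (fun s : ℝ => B (s⁻¹ • (z s - z 0)) (s⁻¹ • (z s - z 0))) (𝓝[>] 0)
        (𝓝 (B w w)) :=
      ((B.continuous.clm_apply continuous_id).tendsto w).comp hq
    refine le_of_tendsto_of_tendsto h1 ((hq.norm.pow 2).const_mul η) ?_
    filter_upwards [hle, self_mem_nhdsWithin, hzt.eventually (Metric.ball_mem_nhds _ hρ)]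
      with s hs hpos hzs
    have hpos' : (0 : ℝ) < s := hpos
    set Δ := z s - z 0 with hΔ
    have hΔρ : ‖Δ‖ < ρ := by rwa [hΔ, ← dist_eq_norm]
    have hmem : ∀ θ ∈ Set.Icc (0 : ℝ) 1, z 0 + θ • Δ ∈ Metric.ball (z 0) ρ := by
      intro θ hθ
      rw [Metric.mem_ball, dist_eq_norm, add_sub_cancel_left, norm_smul, Real.norm_of_nonneg hθ.1]
      exact (mul_le_of_le_one_left (norm_nonneg _) hθ.2).trans_lt hΔρ
    have hder : ∀ θ ∈ Set.Icc (0 : ℝ) 1,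
        HasDerivAt (fun θ : ℝ => f (z 0 + θ • Δ)) (f' (z 0 + θ • Δ) Δ) θ := by
      intro θ hθ
      have : HasDerivAt (fun θ : ℝ => z 0 + θ • Δ) Δ θ := by
        simpa using ((hasDerivAt_id θ).smul_const Δ).const_add (z 0)
      exact (hball _ (hmem θ hθ)).1.comp_hasDerivAt θ this
    obtain ⟨θ, hθ, hmv⟩ := exists_hasDerivAt_eq_slope (fun θ : ℝ => f (z 0 + θ • Δ))
      (fun θ => f' (z 0 + θ • Δ) Δ) zero_lt_one
      (fun θ hθ => (hder θ hθ).continuousAt.continuousWithinAt)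
      (fun θ hθ => hder θ (Set.Ioo_subset_Icc_self hθ))
    have hend : z 0 + (1 : ℝ) • Δ = z s := by simp [hΔ]
    simp only [hend, zero_smul, add_zero, sub_zero, div_one] at hmv
    have hb := (hball _ (hmem θ (Set.Ioo_subset_Icc_self hθ))).2
    rw [ha, sub_zero, add_sub_cancel_left, norm_smul, Real.norm_of_nonneg hθ.1.le] at hb
    have hb' : |f' (z 0 + θ • Δ) Δ - θ * B Δ Δ| ≤ η * (θ * ‖Δ‖) * ‖Δ‖ := by
      have := (f' (z 0 + θ • Δ) - B (θ • Δ)).le_of_opNorm_le hb Δ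
      simpa using this
    have h2 : θ * B Δ Δ ≤ θ * (η * ‖Δ‖ ^ 2) := by
      have := (abs_le.1 hb').1
      nlinarith
    have h3 : B Δ Δ ≤ η * ‖Δ‖ ^ 2 := le_of_mul_le_mul_left h2 hθ.1
    have h4 : B (s⁻¹ • Δ) (s⁻¹ • Δ) = s⁻¹ ^ 2 * B Δ Δ := by
      simp
      ring
    rw [h4, norm_smul, Real.norm_of_nonneg (inv_nonneg.2 hpos'.le), mul_pow]
    nlinarith [sq_nonneg s⁻¹]
  refine le_of_forall_pos_le_add fun κ hκ => ?_
  -- The added `1` covers the case `w = 0`.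
  have := key (κ / (‖w‖ ^ 2 + 1)) (by positivity)
  have h5 : κ / (‖w‖ ^ 2 + 1) * ‖w‖ ^ 2 ≤ κ := by
    rw [div_mul_eq_mul_div, div_le_iff₀ (by positivity)]
    nlinarith
  linarith

end Curves

/-! ### The explicit least-squares multiplier -/

section Multiplier

variable {ι κ : Type*} [Fintype ι] [Fintype κ] [DecidableEq κ]

/-- The candidate solution `λ = -(A A')⁻¹ A b` of the equation `b + A' λ = 0`. -/
def multiplier (A : Matrix κ ι ℝ) (b : ι → ℝ) : κ → ℝ :=
  -((A * A.transpose).det⁻¹ • ((A * A.transpose).adjugate.mulVec (A.mulVec b)))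

/-- The inverse serves the algebra; the determinant and adjugate in the definition serve
measurability and continuity. -/
theorem multiplier_eq (A : Matrix κ ι ℝ) (b : ι → ℝ) :
    multiplier A b = -((A * A.transpose)⁻¹.mulVec (A.mulVec b)) := by
  rw [multiplier, Matrix.inv_def, Ring.inverse_eq_inv', Matrix.smul_mulVec]

theorem mulVec_transpose_mulVec_inv {A : Matrix κ ι ℝ} (hA : (A * A.transpose).det ≠ 0)
    (c : κ → ℝ) : A.mulVec (A.transpose.mulVec ((A * A.transpose)⁻¹.mulVec c)) = c := by
  rw [Matrix.mulVec_mulVec, Matrix.mulVec_mulVec, Matrix.mul_nonsing_inv _ (isUnit_iff_ne_zero.2 hA),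
    Matrix.one_mulVec]

/-- The choice of multiplier puts the residual `q` in the kernel of `A`. There it is orthogonal to
`b` by hypothesis and to the range of `A'` automatically, hence to itself. -/
theorem add_transpose_mulVec_multiplier {A : Matrix κ ι ℝ} (hA : (A * A.transpose).det ≠ 0)
    {b : ι → ℝ} (hb : ∀ w, A.mulVec w = 0 → b ⬝ᵥ w = 0) :
    b + A.transpose.mulVec (multiplier A b) = 0 := by
  set q := b + A.transpose.mulVec (multiplier A b) with hq
  have hAq : A.mulVec q = 0 := by
    rw [hq, Matrix.mulVec_add, multiplier_eq, Matrix.mulVec_neg, Matrix.mulVec_neg,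
      mulVec_transpose_mulVec_inv hA, add_neg_cancel]
  have h1 : q ⬝ᵥ q = 0 := by
    conv_lhs => rw [hq, add_dotProduct]
    rw [← hq, hb q hAq, Matrix.mulVec_transpose, ← Matrix.dotProduct_mulVec, hAq]
    simp
  exact dotProduct_self_eq_zero.1 h1

end Multiplier

/-! ### Finite-dimensional first- and second-order conditions -/

section FiniteDimensional

variable {n p m : ℕ} {H : Vec n → Vec p} {G : Vec n → Vec m} {a : Vec n}

theorem sum_gradient_mul (f : Vec n → ℝ) (x v : Vec n) :
    ∑ l, gradient f x l * v l = fderiv ℝ f x v := by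
  rw [← inner_gradient_left, PiLp.inner_apply]
  simp [mul_comm]

theorem jacobianMatrix_mulVec {k : ℕ} (F : Vec n → Vec k) (x : Vec n) (v : Fin n → ℝ) (i : Fin k) :
    (jacobianMatrix F x).mulVec v i = fderiv ℝ (fun y => F y i) x (WithLp.toLp 2 v) := by
  rw [← sum_gradient_mul]
  rfl

/-- The Jacobian of the constraints with slack variables, for the constraint maps `H` and `G`. -/
def slackJacobian (H : Vec n → Vec p) (G : Vec n → Vec m) (a : Vec n) :
    Matrix (Fin p ⊕ Fin m) (Fin n ⊕ Fin m) ℝ :=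
  Matrix.fromBlocks (jacobianMatrix H a) 0 (jacobianMatrix G a)
    (Matrix.diagonal fun j => -2 * Real.sqrt (G a j))

theorem slackJacobian_mulVec_inl (w : Fin n ⊕ Fin m → ℝ) (i : Fin p) :
    (slackJacobian H G a).mulVec w (Sum.inl i) =
      fderiv ℝ (fun y => H y i) a (WithLp.toLp 2 (w ∘ Sum.inl)) := by
  rw [slackJacobian, Matrix.fromBlocks_mulVec, Sum.elim_inl, Matrix.zero_mulVec, add_zero,
    jacobianMatrix_mulVec]

theorem slackJacobian_mulVec_inr (w : Fin n ⊕ Fin m → ℝ) (j : Fin m) :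
    (slackJacobian H G a).mulVec w (Sum.inr j) =
      fderiv ℝ (fun y => G y j) a (WithLp.toLp 2 (w ∘ Sum.inl)) +
        -2 * Real.sqrt (G a j) * w (Sum.inr j) := by
  rw [slackJacobian, Matrix.fromBlocks_mulVec, Sum.elim_inr, Pi.add_apply,
    jacobianMatrix_mulVec, Matrix.mulVec_diagonal]
  rfl

theorem ContDiffAt.proj_euclidean {k : ℕ} {N : WithTop ℕ∞} {F : Vec n → Vec k}
    (hF : ContDiffAt ℝ N F a) (i : Fin k) : ContDiffAt ℝ N (fun y => F y i) a :=
  (EuclideanSpace.proj (𝕜 := ℝ) i).contDiff.contDiffAt.comp a hF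

/-- Under the full rank condition, every direction along which the active constraints do not
decrease is tangent to a feasible curve. -/
theorem exists_feasible_curve (hH : ContDiffAt ℝ 1 H a) (hG : ContDiffAt ℝ 1 G a)
    (hH0 : H a = 0) (hG0 : ∀ j, 0 ≤ G a j)
    (hdet : (slackJacobian H G a * (slackJacobian H G a).transpose).det ≠ 0)
    {w : Fin n ⊕ Fin m → ℝ}
    (hwH : ∀ i, (slackJacobian H G a).mulVec w (Sum.inl i) = 0)
    (hwG : ∀ j, G a j = 0 → 0 ≤ (slackJacobian H G a).mulVec w (Sum.inr j)) :
    ∃ z : ℝ → Vec n, z 0 = a ∧ HasDerivAt z (WithLp.toLp 2 (w ∘ Sum.inl)) 0 ∧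
      ∀ᶠ s in 𝓝[>] 0, H (z s) = 0 ∧ (∀ j, 0 ≤ G (z s) j) ∧
        ∀ j, G a j = 0 → (slackJacobian H G a).mulVec w (Sum.inr j) = 0 → G (z s) j = 0 := by
  set A := slackJacobian H G a with hA
  set c := A.mulVec w with hc
  let X := Vec n × (Fin m → ℝ) × ℝ
  -- The variables are the point, a slack entering linearly, and a parameter `τ` that makes `(w, 1)`
  -- a kernel vector of the derivative even when `c = A w` is nonzero. On the level set an active
  -- constraint has slack coefficient `0`, so it equals `τ c_j` exactly.
  let f : X → (Fin p ⊕ Fin m → ℝ) := fun q => Sum.elim (fun i => H q.1 i - q.2.2 * c (Sum.inl i))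
    (fun j => G q.1 j + -2 * Real.sqrt (G a j) * q.2.1 j - q.2.2 * c (Sum.inr j))
  let P1 : X →L[ℝ] Vec n := ContinuousLinearMap.fst ℝ _ _
  let P2 : X →L[ℝ] (Fin m → ℝ) :=
    (ContinuousLinearMap.fst ℝ _ _).comp (ContinuousLinearMap.snd ℝ _ _)
  let P3 : X →L[ℝ] ℝ := (ContinuousLinearMap.snd ℝ _ _).comp (ContinuousLinearMap.snd ℝ _ _)
  let f' : X →L[ℝ] (Fin p ⊕ Fin m → ℝ) := ContinuousLinearMap.pi (Sum.elim
    (fun i => (fderiv ℝ (fun y => H y i) a).comp P1 - c (Sum.inl i) • P3)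
    (fun j => (fderiv ℝ (fun y => G y j) a).comp P1 +
      (-2 * Real.sqrt (G a j)) • (ContinuousLinearMap.proj j).comp P2 - c (Sum.inr j) • P3))
  have hf'A : ∀ (y : Fin n ⊕ Fin m → ℝ) (τ : ℝ),
      f' (WithLp.toLp 2 (y ∘ Sum.inl), y ∘ Sum.inr, τ) = A.mulVec y - τ • c := by
    intro y τ
    funext k
    rcases k with i | j
    · change fderiv ℝ (fun y => H y i) a (WithLp.toLp 2 (y ∘ Sum.inl)) - c (Sum.inl i) * τ =
        A.mulVec y (Sum.inl i) - τ * c (Sum.inl i)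
      rw [hA, slackJacobian_mulVec_inl, mul_comm τ]
    · change fderiv ℝ (fun y => G y j) a (WithLp.toLp 2 (y ∘ Sum.inl)) +
        -2 * Real.sqrt (G a j) * y (Sum.inr j) - c (Sum.inr j) * τ =
        A.mulVec y (Sum.inr j) - τ * c (Sum.inr j)
      rw [hA, slackJacobian_mulVec_inr, mul_comm τ]
  have hf : HasStrictFDerivAt f f' (a, 0, 0) := by
    rw [hasStrictFDerivAt_pi]
    have e1 : HasStrictFDerivAt (fun q : X => q.1) P1 (a, 0, 0) := P1.hasStrictFDerivAt
    have e2 : HasStrictFDerivAt (fun q : X => q.2.1) P2 (a, 0, 0) := P2.hasStrictFDerivAt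
    have e3 : HasStrictFDerivAt (fun q : X => q.2.2) P3 (a, 0, 0) := P3.hasStrictFDerivAt
    rintro (i | j)
    · have h1 : HasStrictFDerivAt (fun y => H y i) (fderiv ℝ (fun y => H y i) a)
          ((a, 0, 0) : X).1 := (hH.proj_euclidean i).hasStrictFDerivAt one_ne_zero
      exact (h1.comp _ e1).sub (e3.mul_const (c (Sum.inl i)))
    · have h1 : HasStrictFDerivAt (fun y => G y j) (fderiv ℝ (fun y => G y j) a)
          ((a, 0, 0) : X).1 := (hG.proj_euclidean j).hasStrictFDerivAt one_ne_zero
      exact ((h1.comp _ e1).add (((ContinuousLinearMap.proj (R := ℝ) (φ := fun _ : Fin m => ℝ)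
        j).hasStrictFDerivAt.comp _ e2).const_mul _)).sub (e3.mul_const (c (Sum.inr j)))
  have hsurj : Function.Surjective f' := by
    intro b
    refine ⟨_, (hf'A (A.transpose.mulVec ((A * A.transpose)⁻¹.mulVec b)) 0).trans ?_⟩
    rw [mulVec_transpose_mulVec_inv hdet, zero_smul, sub_zero]
  obtain ⟨q, hq0, hq, hqf⟩ := hf.exists_curve hsurj
    ((hf'A w 1).trans (by rw [one_smul, ← hc, sub_self]))
  have hz : HasDerivAt (fun s => (q s).1) (WithLp.toLp 2 (w ∘ Sum.inl)) 0 :=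
    P1.hasFDerivAt.comp_hasDerivAt (0 : ℝ) hq
  have hτ : HasDerivAt (fun s => (q s).2.2) 1 0 := P3.hasFDerivAt.comp_hasDerivAt (0 : ℝ) hq
  -- `τ` vanishes at `0` with derivative `1`, so `τ c_j` has the sign of `c_j` for small positive
  -- `s`.
  have hτpos : ∀ᶠ s in 𝓝[>] 0, 0 < (q s).2.2 := by
    have h1 := hτ.tendsto_slope_zero_right.eventually (lt_mem_nhds zero_lt_one)
    filter_upwards [h1, self_mem_nhdsWithin] with s hs hpos
    simp only [zero_add, hq0, sub_zero, smul_eq_mul] at hs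
    exact (pos_iff_pos_of_mul_pos hs).1 (inv_pos.2 hpos)
  refine ⟨fun s => (q s).1, by simp [hq0], hz, ?_⟩
  have hinact : ∀ᶠ s in 𝓝[>] 0, ∀ j, 0 < G a j → 0 < G (q s).1 j := by
    refine eventually_all.2 fun j => ?_
    by_cases hj : 0 < G a j
    · have h1 : ContinuousAt (fun y => G y j) (q 0).1 := by
        simpa [hq0] using (hG.proj_euclidean j).continuousAt
      have h2 : Tendsto (fun s => G (q s).1 j) (𝓝 0) (𝓝 (G a j)) := by
        have := h1.tendsto.comp hz.continuousAt.tendsto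
        rw [hq0] at this
        exact this
      exact ((h2.eventually (lt_mem_nhds hj)).filter_mono nhdsWithin_le_nhds).mono
        fun s hs _ => hs
    · exact Eventually.of_forall fun s hs => absurd hs hj
  filter_upwards [hτpos, hinact, hqf.filter_mono nhdsWithin_le_nhds] with s hs hin hfs
  have hHs : ∀ i, H (q s).1 i = 0 := by
    intro i
    have := congrFun hfs (Sum.inl i)
    simp only [f, Sum.elim_inl, hwH, mul_zero, sub_zero, hH0] at this
    simpa using this
  have hGs : ∀ j, G a j = 0 → G (q s).1 j = (q s).2.2 * c (Sum.inr j) := by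
    intro j hj
    have := congrFun hfs (Sum.inr j)
    simp only [f, Sum.elim_inr, hj, Real.sqrt_zero] at this
    simp at this
    linarith
  refine ⟨?_, fun j => ?_, fun j hj hcj => by rw [hGs j hj, hcj, mul_zero]⟩
  · ext i
    exact hHs i
  · rcases (hG0 j).eq_or_lt with hj | hj
    · rw [hGs j hj.symm]
      exact mul_nonneg hs.le (hwG j hj.symm)
    · exact (hin j hj).le

/-- The vector `(∇f(a), 0)`. -/
def extendedGradient (m : ℕ) (f : Vec n → ℝ) (a : Vec n) : Fin n ⊕ Fin m → ℝ :=
  Sum.elim (fun k => gradient f a k) 0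

theorem extendedGradient_dotProduct (f : Vec n → ℝ) (w : Fin n ⊕ Fin m → ℝ) :
    extendedGradient m f a ⬝ᵥ w = fderiv ℝ f a (WithLp.toLp 2 (w ∘ Sum.inl)) := by
  rw [← sum_gradient_mul, dotProduct, Fintype.sum_sum_type]
  simp [extendedGradient]

variable {f : Vec n → ℝ}

/-- First-order necessary condition with the explicit multipliers. -/
theorem first_order_condition (hf : DifferentiableAt ℝ f a)
    (hH : ContDiffAt ℝ 1 H a) (hG : ContDiffAt ℝ 1 G a)
    (hH0 : H a = 0) (hG0 : ∀ j, 0 ≤ G a j)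
    (hdet : (slackJacobian H G a * (slackJacobian H G a).transpose).det ≠ 0)
    (hmax : ∀ᶠ y in 𝓝 a, H y = 0 → (∀ j, 0 ≤ G y j) → f y ≤ f a)
    {l : Fin p ⊕ Fin m → ℝ}
    (hl : l = multiplier (slackJacobian H G a) (extendedGradient m f a)) :
    gradient f a + ∑ i, l (Sum.inl i) • gradient (fun y => H y i) a
        + ∑ j, l (Sum.inr j) • gradient (fun y => G y j) a = 0 ∧
      (∀ j, 0 ≤ l (Sum.inr j)) ∧ ∀ j, l (Sum.inr j) * G a j = 0 := by
  set A := slackJacobian H G a with hA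
  set b := extendedGradient m f a with hb
  have hdir : ∀ w, (∀ i, A.mulVec w (Sum.inl i) = 0) →
      (∀ j, G a j = 0 → 0 ≤ A.mulVec w (Sum.inr j)) → b ⬝ᵥ w ≤ 0 := by
    intro w h1 h2
    obtain ⟨z, hz0, hz, hfeas⟩ := exists_feasible_curve hH hG hH0 hG0 hdet h1 h2
    rw [hb, extendedGradient_dotProduct]
    refine hf.hasFDerivAt.apply_nonpos_of_curve hz0 hz ?_
    have hzt : Tendsto z (𝓝[>] 0) (𝓝 a) := by
      have := hz.continuousAt.tendsto
      rw [hz0] at this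
      exact this.mono_left nhdsWithin_le_nhds
    filter_upwards [hzt.eventually hmax, hfeas] with s hs hs'
    exact hs hs'.1 hs'.2.1
  -- Both `w` and `-w` are admissible directions.
  have hker : ∀ w, A.mulVec w = 0 → b ⬝ᵥ w = 0 := by
    intro w hw
    refine le_antisymm (hdir w (by simp [hw]) (by simp [hw])) ?_
    have := hdir (-w) (by simp [Matrix.mulVec_neg, hw]) (by simp [Matrix.mulVec_neg, hw])
    rw [dotProduct_neg] at this
    linarith
  have hkkt : b + A.transpose.mulVec l = 0 := by
    rw [hl]
    exact add_transpose_mulVec_multiplier hdet hker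
  -- The slack entries of `b` are zero, so the slack rows of `b + A' l = 0` read `-2 √(G_j) l_j =
  -- 0`.
  have hcomp : ∀ j, Real.sqrt (G a j) * l (Sum.inr j) = 0 := by
    intro j
    have := congrFun hkkt (Sum.inr j)
    rw [hA, slackJacobian, Matrix.fromBlocks_transpose, Matrix.fromBlocks_mulVec] at this
    simp [hb, extendedGradient, Matrix.mulVec_diagonal] at this
    rcases this with h | h <;> simp [h]
  refine ⟨?_, fun j => ?_, fun j => ?_⟩
  · ext k
    have := congrFun hkkt (Sum.inl k)
    rw [hA, slackJacobian, Matrix.fromBlocks_transpose, Matrix.fromBlocks_mulVec] at this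
    simp only [hb, extendedGradient, Pi.add_apply, Sum.elim_inl, Matrix.mulVec, dotProduct,
      Matrix.transpose_apply, jacobianMatrix, Matrix.of_apply, Pi.zero_apply,
      Function.comp_apply] at this
    simp only [PiLp.add_apply, WithLp.ofLp_sum, Finset.sum_apply, PiLp.smul_apply, smul_eq_mul,
      PiLp.zero_apply]
    rw [← this, add_assoc]
    simp [mul_comm]
  · rcases (hG0 j).eq_or_lt with hj | hj
    -- A direction with `A w = e_j` increases only the active constraint `j`. Pairing `b + A' l = 0`
    -- with it gives `l_j = -(b ⬝ᵥ w) ≥ 0`.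
    · let e : Fin p ⊕ Fin m → ℝ := Pi.single (Sum.inr j) 1
      set w := A.transpose.mulVec ((A * A.transpose)⁻¹.mulVec e) with hw
      have hAw : A.mulVec w = e := mulVec_transpose_mulVec_inv hdet e
      have h1 : b ⬝ᵥ w ≤ 0 := hdir w (by simp [hAw, e]) (fun k _ => by
        rw [hAw]
        by_cases hkj : k = j <;> simp [e, hkj])
      have h2 : b ⬝ᵥ w + l ⬝ᵥ e = 0 := by
        have h4 : l ⬝ᵥ A.mulVec w = A.transpose.mulVec l ⬝ᵥ w := by
          rw [Matrix.mulVec_transpose, Matrix.dotProduct_mulVec]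
        rw [← hAw, h4, ← add_dotProduct, hkkt, zero_dotProduct]
      have h3 : l ⬝ᵥ e = l (Sum.inr j) := by simp [e]
      linarith
    · have := hcomp j
      rcases mul_eq_zero.1 this with h | h
      · exact absurd (Real.sqrt_pos.2 hj) (by simp [h])
      · rw [h]
  · rw [← Real.mul_self_sqrt (hG0 j)]
    linear_combination (Real.sqrt (G a j)) * hcomp j

/-- Second-order necessary condition. -/
theorem second_order_condition (hf : ContDiffAt ℝ 2 f a)
    (hH : ContDiffAt ℝ 2 H a) (hG : ContDiffAt ℝ 2 G a)
    (hH0 : H a = 0) (hG0 : ∀ j, 0 ≤ G a j)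
    (hdet : (slackJacobian H G a * (slackJacobian H G a).transpose).det ≠ 0)
    (hmax : ∀ᶠ y in 𝓝 a, H y = 0 → (∀ j, 0 ≤ G y j) → f y ≤ f a)
    {u : Fin p → ℝ} {v : Fin m → ℝ}
    (hstat : gradient f a + ∑ i, u i • gradient (fun y => H y i) a
        + ∑ j, v j • gradient (fun y => G y j) a = 0)
    (hv : ∀ j, v j * G a j = 0)
    {γ : Vec n} (hγH : ∀ i, inner ℝ (gradient (fun y => H y i) a) γ = 0)
    (hγG : ∀ j, G a j = 0 → inner ℝ (gradient (fun y => G y j) a) γ = 0) :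
    hessianForm f a γ + ∑ i, u i * hessianForm (fun y => H y i) a γ
      + ∑ j, v j * hessianForm (fun y => G y j) a γ ≤ 0 := by
  -- The slack entries complete `γ` to a kernel vector of the slack Jacobian. At active `j` the
  -- division by zero yields `0`, harmless because its coefficient is also zero.
  let w : Fin n ⊕ Fin m → ℝ := Sum.elim γ fun j =>
    fderiv ℝ (fun y => G y j) a γ / (2 * Real.sqrt (G a j))
  have hwγ : WithLp.toLp 2 (w ∘ Sum.inl) = γ := by
    ext k
    simp [w]
  have hw1 : ∀ i, (slackJacobian H G a).mulVec w (Sum.inl i) = 0 := by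
    intro i
    rw [slackJacobian_mulVec_inl, hwγ, ← inner_gradient_left, hγH]
  have hw2 : ∀ j, G a j = 0 → (slackJacobian H G a).mulVec w (Sum.inr j) = 0 := by
    intro j hj
    rw [slackJacobian_mulVec_inr, hwγ, ← inner_gradient_left, hγG j hj, hj]
    simp
  obtain ⟨z, hz0, hz, hfeas⟩ := exists_feasible_curve (hH.of_le one_le_two) (hG.of_le one_le_two)
    hH0 hG0 hdet hw1 (fun j hj => (hw2 j hj).ge)
  rw [hwγ] at hz
  have hzt : Tendsto z (𝓝[>] 0) (𝓝 a) := by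
    have := hz.continuousAt.tendsto
    rw [hz0] at this
    exact this.mono_left nhdsWithin_le_nhds
  have hd1 : ∀ {F : Vec n → ℝ}, ContDiffAt ℝ 2 F a →
      ∀ᶠ x in 𝓝 a, HasFDerivAt F (fderiv ℝ F x) x := fun {F} hF => by
    filter_upwards [hF.eventually (by simp)] with x hx
    exact (hx.differentiableAt two_ne_zero).hasFDerivAt
  have hd2 : ∀ {F : Vec n → ℝ}, ContDiffAt ℝ 2 F a →
      HasFDerivAt (fderiv ℝ F) (fderiv ℝ (fderiv ℝ F) a) a := fun {F} hF =>
    ((hF.fderiv_right (m := 1) (by norm_num)).differentiableAt one_ne_zero).hasFDerivAt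
  have hL : ∀ᶠ x in 𝓝 a, HasFDerivAt
      (fun y => f y + ∑ i, u i * H y i + ∑ j, v j * G y j)
      (fderiv ℝ f x + ∑ i, u i • fderiv ℝ (fun y => H y i) x +
        ∑ j, v j • fderiv ℝ (fun y => G y j) x) x := by
    filter_upwards [hd1 hf, eventually_all.2 fun i => hd1 (hH.proj_euclidean i),
      eventually_all.2 fun j => hd1 (hG.proj_euclidean j)] with x h1 h2 h3
    exact (h1.add (HasFDerivAt.fun_sum fun i _ => (h2 i).const_mul (u i))).add
      (HasFDerivAt.fun_sum fun j _ => (h3 j).const_mul (v j))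
  have hL' : HasFDerivAt (fun x => fderiv ℝ f x + ∑ i, u i • fderiv ℝ (fun y => H y i) x +
        ∑ j, v j • fderiv ℝ (fun y => G y j) x)
      (fderiv ℝ (fderiv ℝ f) a + ∑ i, u i • fderiv ℝ (fderiv ℝ fun y => H y i) a +
        ∑ j, v j • fderiv ℝ (fderiv ℝ fun y => G y j) a) a :=
    ((hd2 hf).add (HasFDerivAt.fun_sum fun i _ =>
      (hd2 (hH.proj_euclidean i)).const_smul (u i))).add
      (HasFDerivAt.fun_sum fun j _ => (hd2 (hG.proj_euclidean j)).const_smul (v j))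
  have hcrit : fderiv ℝ f a + ∑ i, u i • fderiv ℝ (fun y => H y i) a +
        ∑ j, v j • fderiv ℝ (fun y => G y j) a = 0 := by
    ext x
    have := congrArg (fun q => inner ℝ q x) hstat
    simpa [inner_add_left, sum_inner, inner_smul_left, inner_gradient_left] using this
  -- The Lagrangian equals `f` along the curve: for each `j` either `v j = 0`, or `j` is active and
  -- stays exactly zero.
  have hle : ∀ᶠ s in 𝓝[>] 0, f (z s) + ∑ i, u i * H (z s) i + ∑ j, v j * G (z s) j ≤
      f a + ∑ i, u i * H a i + ∑ j, v j * G a j := by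
    filter_upwards [hzt.eventually hmax, hfeas] with s hs hs'
    have h1 : ∀ j, v j * G (z s) j = 0 := by
      intro j
      rcases mul_eq_zero.1 (hv j) with h | h
      · rw [h, zero_mul]
      · rw [hs'.2.2 j h (hw2 j h), mul_zero]
    simpa [h1, hv, hs'.1, hH0] using hs hs'.1 hs'.2.1
  have := HasFDerivAt.apply_apply_nonpos_of_curve hL hL' hcrit hz0 hz hle
  simpa [hessianForm] using this

end FiniteDimensional

/-! ### Measurability and boundedness of the multiplier -/

section MultiplierRegularity

variable {ι κ : Type*} [Fintype ι] [Fintype κ] [DecidableEq κ]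

theorem measurable_multiplier :
    Measurable fun q : (κ → ι → ℝ) × (ι → ℝ) => multiplier (Matrix.of q.1) q.2 := by
  have hA : Continuous fun q : (κ → ι → ℝ) × (ι → ℝ) => Matrix.of q.1 := continuous_fst
  have hAA := hA.matrix_mul hA.matrix_transpose
  exact (hAA.matrix_det.measurable.inv.smul
    (hAA.matrix_adjugate.matrix_mulVec (hA.matrix_mulVec continuous_snd)).measurable).neg

theorem continuousOn_multiplier :
    ContinuousOn (fun q : (κ → ι → ℝ) × (ι → ℝ) => multiplier (Matrix.of q.1) q.2)
      {q | (Matrix.of q.1 * (Matrix.of q.1).transpose).det ≠ 0} := by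
  have hA : Continuous fun q : (κ → ι → ℝ) × (ι → ℝ) => Matrix.of q.1 := continuous_fst
  have hAA := hA.matrix_mul hA.matrix_transpose
  exact ((hAA.matrix_det.continuousOn.inv₀ fun q hq => hq).smul
    (hAA.matrix_adjugate.matrix_mulVec (hA.matrix_mulVec continuous_snd)).continuousOn).neg

/-- Essential boundedness of the multipliers. -/
theorem memLp_multiplier {α : Type*} [MeasurableSpace α] {μ : Measure α}
    {A : α → Matrix κ ι ℝ} {b : α → ι → ℝ}
    (hA : ∀ k i, AEMeasurable (fun t => A t k i) μ) (hb : ∀ i, AEMeasurable (fun t => b t i) μ)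
    {C K : ℝ} (hC : 0 ≤ C) (hK : 0 < K) (hAC : ∀ᵐ t ∂μ, ∀ k i, |A t k i| ≤ C)
    (hbC : ∀ᵐ t ∂μ, ∀ i, |b t i| ≤ C) (hdet : ∀ᵐ t ∂μ, K ≤ (A t * (A t).transpose).det)
    {k : ℕ} {Φ : (κ → ℝ) → Vec k} (hΦ : Continuous Φ) :
    MemLp (fun t => Φ (multiplier (A t) (b t))) ⊤ μ := by
  -- Almost all data lie in this compact set, on which the multiplier is continuous and therefore
  -- bounded.
  let S : Set ((κ → ι → ℝ) × (ι → ℝ)) := Metric.closedBall 0 C ∩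
    {q | K ≤ (Matrix.of q.1 * (Matrix.of q.1).transpose).det}
  have hAc : Continuous fun q : (κ → ι → ℝ) × (ι → ℝ) => Matrix.of q.1 := continuous_fst
  have hS : IsCompact S := (isCompact_closedBall _ _).inter_right
    (isClosed_le continuous_const (hAc.matrix_mul hAc.matrix_transpose).matrix_det)
  obtain ⟨M, hM⟩ := hS.exists_bound_of_continuousOn
    (hΦ.comp_continuousOn (continuousOn_multiplier.mono fun q hq => (hK.trans_le hq.2).ne'))
  let a : α → (κ → ι → ℝ) × (ι → ℝ) := fun t => (fun k i => A t k i, b t)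
  have hq : AEMeasurable a μ :=
    (aemeasurable_pi_lambda _ fun k => aemeasurable_pi_lambda _ fun i => hA k i).prodMk
      (aemeasurable_pi_lambda _ hb)
  refine memLp_top_of_bound
    ((hΦ.measurable.comp measurable_multiplier).comp_aemeasurable hq).aestronglyMeasurable M ?_
  filter_upwards [hAC, hbC, hdet] with t h1 h2 h3
  refine hM (a t) ⟨?_, h3⟩
  rw [mem_closedBall_zero_iff, Prod.norm_def, max_le_iff]
  exact ⟨(pi_norm_le_iff_of_nonneg hC).2 fun k => (pi_norm_le_iff_of_nonneg hC).2 fun i => h1 k i,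
    (pi_norm_le_iff_of_nonneg hC).2 h2⟩

end MultiplierRegularity

/-! ### Verification of the data bounds and assembly -/

section Main

variable {n p m : ℕ} {T : ℝ} {φ : Vec n → ℝ → ℝ} {h : Vec n → ℝ → Vec p} {g : Vec n → ℝ → Vec m}
  {zbar : ℝ → Vec n} {ε : ℝ}

theorem gradient_apply_eq_fderiv (f : Vec n → ℝ) (x : Vec n) (l : Fin n) :
    gradient f x l = fderiv ℝ f x (EuclideanSpace.single l 1) := by
  rw [← sum_gradient_mul]
  simp

theorem aemeasurable_gradient_apply {μ : Measure ℝ} {f : Vec n → ℝ → ℝ} (hε : 0 < ε)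
    (hzb : AEMeasurable zbar μ)
    (hf : ∀ z : ℝ → Vec n, AEMeasurable z μ →
      AEMeasurable (fun t => if dist (z t) (zbar t) < ε then f (z t) t else 0) μ)
    (hd : ∀ᵐ t ∂μ, ∀ x ∈ Metric.ball (zbar t) ε, DifferentiableAt ℝ (fun y => f y t) x)
    (l : Fin n) : AEMeasurable (fun t => gradient (fun y => f y t) (zbar t) l) μ := by
  have := aemeasurable_fderiv_comp hzb hf hd (aemeasurable_const (b := EuclideanSpace.single l 1))
    hzb
  simpa only [dist_self, if_pos hε, ← gradient_apply_eq_fderiv] using this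

theorem ContDiffOn.differentiableAt_of_mem_ball {k : ℕ} {F : Vec n → Vec k} {a x : Vec n}
    {N : ℕ} (hN : N ≠ 0) (hF : ContDiffOn ℝ N F (Metric.closedBall a ε))
    (hx : x ∈ Metric.ball a ε) (i : Fin k) : DifferentiableAt ℝ (fun y => F y i) x :=
  ((hF.contDiffAt (mem_of_superset (Metric.isOpen_ball.mem_nhds hx)
    Metric.ball_subset_closedBall)).proj_euclidean i).differentiableAt (by exact_mod_cast hN)

theorem ContDiffAt.differentiableAt_fderiv {E : Type*} [NormedAddCommGroup E] [NormedSpace ℝ E]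
    {f : E → ℝ} {x : E} (hf : ContDiffAt ℝ 2 f x) :
    DifferentiableAt ℝ (fun y => fderiv ℝ f y) x :=
  (hf.fderiv_right (m := 1) (by norm_num)).differentiableAt one_ne_zero

theorem ConstraintsUniform.ae_gradient_bound (hε : 0 < ε)
    (hreg : ConstraintsRegular T h g ε zbar) (hunif : ConstraintsUniform T h g ε zbar) :
    ∃ C, 0 ≤ C ∧ ∀ᵐ t ∂timeMeasure T,
      (∀ i l, |gradient (fun z => h z t i) (zbar t) l| ≤ C) ∧
      ∀ j l, |gradient (fun z => g z t j) (zbar t) l| ≤ C := by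
  obtain ⟨C, hC, hbound⟩ := hunif.bound
  refine ⟨C, hC.le, ?_⟩
  filter_upwards [hbound, hreg.contDiff] with t ht hcd
  have hnhds := Metric.closedBall_mem_nhds (zbar t) hε
  have hh : DifferentiableAt ℝ (fun z => h z t) (zbar t) :=
    (hcd.1.contDiffAt hnhds).differentiableAt one_ne_zero
  have hg : DifferentiableAt ℝ (fun z => g z t) (zbar t) :=
    (hcd.2.contDiffAt hnhds).differentiableAt one_ne_zero
  have hF := (hh.prodMk hg).hasFDerivAt
  set F' := fderiv ℝ (fun y => (h y t, g y t)) (zbar t) with hF'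
  have hle : ∀ l, ‖F' (EuclideanSpace.single l 1)‖ ≤ C := fun l => by
    simpa using F'.le_of_opNorm_le ht (EuclideanSpace.single l 1)
  constructor
  · intro i l
    have h1 : HasFDerivAt (fun z => h z t i) (((EuclideanSpace.proj (𝕜 := ℝ) i).comp
        (ContinuousLinearMap.fst ℝ (Vec p) (Vec m))).comp F') (zbar t) :=
      ((EuclideanSpace.proj (𝕜 := ℝ) i).comp
        (ContinuousLinearMap.fst ℝ (Vec p) (Vec m))).hasFDerivAt.comp _ hF
    rw [gradient_apply_eq_fderiv, h1.fderiv]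
    exact (PiLp.norm_apply_le (F' (EuclideanSpace.single l 1)).1 i).trans
      ((norm_fst_le _).trans (hle l))
  · intro j l
    have h1 : HasFDerivAt (fun z => g z t j) (((EuclideanSpace.proj (𝕜 := ℝ) j).comp
        (ContinuousLinearMap.snd ℝ (Vec p) (Vec m))).comp F') (zbar t) :=
      ((EuclideanSpace.proj (𝕜 := ℝ) j).comp
        (ContinuousLinearMap.snd ℝ (Vec p) (Vec m))).hasFDerivAt.comp _ hF
    rw [gradient_apply_eq_fderiv, h1.fderiv]
    exact (PiLp.norm_apply_le (F' (EuclideanSpace.single l 1)).2 j).trans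
      ((norm_snd_le _).trans (hle l))

/-- The integral of an a.e. nonpositive function exists and is nonpositive. -/
theorem extIntegral_nonpos {α : Type*} [MeasurableSpace α] {μ : Measure α} {f : α → ℝ}
    (hf : AEMeasurable f μ) (hle : ∀ᵐ x ∂μ, f x ≤ 0) :
    HasExtIntegral f μ ∧ extIntegral f μ ≤ 0 := by
  have h0 : ∫⁻ x, ENNReal.ofReal (f x) ∂μ = 0 := by
    rw [lintegral_eq_zero_iff' hf.ennreal_ofReal]
    filter_upwards [hle] with x hx
    simpa using hx
  refine ⟨⟨hf, Or.inl (by simp [h0])⟩, ?_⟩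
  rw [extIntegral, h0]
  simpa using EReal.coe_ennreal_nonneg _

/-- The map `Φ` extracts a block of the multiplier, so one proof serves both `u` and `v`. -/
theorem memLp_upsilon_multiplier (hzb : AEMeasurable zbar (timeMeasure T))
    (hφ : ObjectiveRegular T φ zbar) (hε : 0 < ε)
    (hreg : ConstraintsRegular T h g ε zbar) (hunif : ConstraintsUniform T h g ε zbar)
    (hrank : UniformFullRank T h g zbar)
    (hbdd : ∃ M : ℝ, ∀ᵐ t ∂timeMeasure T, ‖g (zbar t) t‖ ≤ M)
    {k : ℕ} {Φ : (Fin p ⊕ Fin m → ℝ) → Vec k} (hΦ : Continuous Φ) :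
    MemLp (fun t => Φ (multiplier (upsilon h g zbar t)
      (extendedGradient m (fun z => φ z t) (zbar t)))) ⊤ (timeMeasure T) := by
  obtain ⟨C, hC, hgrad⟩ := hunif.ae_gradient_bound hε hreg
  obtain ⟨Kφ, hKφ, hgradφ⟩ := hφ.gradient_bound
  obtain ⟨M, hM⟩ := hbdd
  obtain ⟨K, hK, hdet⟩ := hrank
  -- One bound for every entry: `C` for the constraint gradients, `Kφ` for the objective gradient,
  -- `2 √M` for the slack diagonal.
  refine memLp_multiplier (C := C + Kφ + 2 * Real.sqrt M) ?_ ?_ (by positivity) hK ?_ ?_ hdet hΦ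
  · have hgm : ∀ j, AEMeasurable (fun t => g (zbar t) t j) (timeMeasure T) := fun j => by
      simpa only [dist_self, if_pos hε] using hreg.aemeasurable_comp_g hzb j hzb
    have hdh : ∀ i, ∀ᵐ t ∂timeMeasure T, ∀ x ∈ Metric.ball (zbar t) ε,
        DifferentiableAt ℝ (fun y => h y t i) x := fun i => by
      filter_upwards [hreg.contDiff] with t ht x hx
      exact ht.1.differentiableAt_of_mem_ball one_ne_zero hx i
    have hdg : ∀ j, ∀ᵐ t ∂timeMeasure T, ∀ x ∈ Metric.ball (zbar t) ε,
        DifferentiableAt ℝ (fun y => g y t j) x := fun j => by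
      filter_upwards [hreg.contDiff] with t ht x hx
      exact ht.2.differentiableAt_of_mem_ball one_ne_zero hx j
    rintro (i | j) (l | k)
    · exact aemeasurable_gradient_apply (f := fun y t => h y t i) hε hzb
        (fun z hz => hreg.aemeasurable_comp_h hzb i hz) (hdh i) l
    · exact aemeasurable_const
    · exact aemeasurable_gradient_apply (f := fun y t => g y t j) hε hzb
        (fun z hz => hreg.aemeasurable_comp_g hzb j hz) (hdg j) l
    · simp only [upsilon, Matrix.fromBlocks_apply₂₂, Matrix.diagonal_apply]
      split_ifs
      · exact (hgm j).sqrt.const_mul _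
      · exact aemeasurable_const
  · rintro (l | k)
    · refine aemeasurable_gradient_apply (f := φ) hε hzb
        (fun z hz => hφ.aemeasurable_comp hzb hz) ?_ l
      filter_upwards [ae_restrict_mem measurableSet_Icc] with t ht x _
      exact (hφ.contDiff t ht).contDiffAt.differentiableAt two_ne_zero
    · exact aemeasurable_const
  · filter_upwards [hgrad, hM] with t ht hMt
    have hs := Real.sqrt_nonneg M
    rintro (i | j) (l | k)
    · exact (ht.1 i l).trans (by linarith)
    · simp only [upsilon, Matrix.fromBlocks_apply₁₂, Matrix.zero_apply, abs_zero]
      positivity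
    · exact (ht.2 j l).trans (by linarith)
    · simp only [upsilon, Matrix.fromBlocks_apply₂₂, Matrix.diagonal_apply]
      split_ifs
      · have h1 : g (zbar t) t j ≤ M :=
          (le_abs_self _).trans ((PiLp.norm_apply_le (g (zbar t) t) j).trans hMt)
        rw [abs_mul, abs_of_nonneg (Real.sqrt_nonneg _)]
        norm_num
        linarith [Real.sqrt_le_sqrt h1]
      · rw [abs_zero]
        positivity
  · filter_upwards [hgradφ] with t ht
    have hs := Real.sqrt_nonneg M
    rintro (l | k)
    · exact ((PiLp.norm_apply_le (gradient (fun z => φ z t) (zbar t)) l).trans ht).trans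
        (by linarith)
    · simp only [extendedGradient, Sum.elim_inr, Pi.zero_apply, abs_zero]
      positivity

theorem aemeasurable_lagrangianHessianForm (hzb : AEMeasurable zbar (timeMeasure T))
    (hφ : ObjectiveRegular T φ zbar) (hε : 0 < ε)
    (hreg : ConstraintsRegular T h g ε zbar) (hcd : ConstraintsContDiff T h g 2 ε zbar)
    {u : ℝ → Vec p} {v : ℝ → Vec m} {γ : ℝ → Vec n} (hu : AEMeasurable u (timeMeasure T))
    (hv : AEMeasurable v (timeMeasure T)) (hγ : AEMeasurable γ (timeMeasure T)) :
    AEMeasurable (lagrangianHessianForm φ h g zbar u v γ) (timeMeasure T) := by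
  refine (AEMeasurable.add ?_ (Finset.aemeasurable_fun_sum _ fun i _ => AEMeasurable.mul ?_ ?_)).add
    (Finset.aemeasurable_fun_sum _ fun j _ => AEMeasurable.mul ?_ ?_)
  · refine aemeasurable_fderiv_fderiv_comp (f := φ) hε hzb
      (fun z hz => hφ.aemeasurable_comp hzb hz) ?_ ?_ hγ
    · filter_upwards [ae_restrict_mem measurableSet_Icc] with t ht x _
      exact (hφ.contDiff t ht).contDiffAt.differentiableAt two_ne_zero
    · filter_upwards [ae_restrict_mem measurableSet_Icc] with t ht
      exact (hφ.contDiff t ht).contDiffAt.differentiableAt_fderiv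
  · exact (EuclideanSpace.proj (𝕜 := ℝ) i).continuous.measurable.comp_aemeasurable hu
  · refine aemeasurable_fderiv_fderiv_comp (f := fun z t => h z t i) hε hzb
      (fun z hz => hreg.aemeasurable_comp_h hzb i hz) ?_ ?_ hγ
    · filter_upwards [hcd] with t ht x hx
      exact ht.1.differentiableAt_of_mem_ball two_ne_zero hx i
    · filter_upwards [hcd] with t ht
      exact ((ht.1.contDiffAt
        (Metric.closedBall_mem_nhds _ hε)).proj_euclidean i).differentiableAt_fderiv
  · exact (EuclideanSpace.proj (𝕜 := ℝ) j).continuous.measurable.comp_aemeasurable hv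
  · refine aemeasurable_fderiv_fderiv_comp (f := fun z t => g z t j) hε hzb
      (fun z hz => hreg.aemeasurable_comp_g hzb j hz) ?_ ?_ hγ
    · filter_upwards [hcd] with t ht x hx
      exact ht.2.differentiableAt_of_mem_ball two_ne_zero hx j
    · filter_upwards [hcd] with t ht
      exact ((ht.2.contDiffAt
        (Metric.closedBall_mem_nhds _ hε)).proj_euclidean j).differentiableAt_fderiv

end Main

end

theorem mainTheorem1 {n p m : ℕ} (T : ℝ) (hT : 0 < T)
    (φ : Vec n → ℝ → ℝ) (h : Vec n → ℝ → Vec p) (g : Vec n → ℝ → Vec m)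
    (zbar : ℝ → Vec n) (hopt : IsLocalOptimal T φ h g zbar)
    (hφ : ObjectiveRegular T φ zbar)
    (ε : ℝ) (hε : 0 < ε)
    (hreg : ConstraintsRegular T h g ε zbar)
    (hunif : ConstraintsUniform T h g ε zbar)
    (hrank : UniformFullRank T h g zbar)
    (hbdd : ∃ M : ℝ, ∀ᵐ t ∂timeMeasure T, ‖g (zbar t) t‖ ≤ M) :
    ∃ (u : ℝ → Vec p) (v : ℝ → Vec m),
      MemLp u ⊤ (timeMeasure T) ∧ MemLp v ⊤ (timeMeasure T) ∧
      (∀ᵐ t ∂timeMeasure T,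
        gradient (fun z => φ z t) (zbar t)
            + ∑ i, u t i • gradient (fun z => h z t i) (zbar t)
            + ∑ j, v t j • gradient (fun z => g z t j) (zbar t) = 0 ∧
        (∀ j, 0 ≤ v t j) ∧
        (∀ j, v t j * g (zbar t) t j = 0)) ∧
      (ConstraintsContDiff T h g 2 ε zbar →
        ∀ γ : ℝ → Vec n, IsCritical T h g zbar γ →
          HasExtIntegral (lagrangianHessianForm φ h g zbar u v γ) (timeMeasure T) ∧
          extIntegral (lagrangianHessianForm φ h g zbar u v γ) (timeMeasure T) ≤ 0) := by
  have hzb : AEMeasurable zbar (timeMeasure T) := hopt.feasible.memLp.1.aemeasurable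
  have hdet : ∀ᵐ t ∂timeMeasure T,
      (upsilon h g zbar t * (upsilon h g zbar t).transpose).det ≠ 0 := by
    obtain ⟨K, hK, hdet⟩ := hrank
    exact hdet.mono fun t ht => (hK.trans_le ht).ne'
  have hmax := hopt.ae_pointwise_max hφ hε hreg
  -- The formula involves first derivatives only, so the same multipliers serve the second-order
  -- statement.
  let l : ℝ → Fin p ⊕ Fin m → ℝ := fun t =>
    multiplier (upsilon h g zbar t) (extendedGradient m (fun z => φ z t) (zbar t))
  let u : ℝ → Vec p := fun t => WithLp.toLp 2 (l t ∘ Sum.inl)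
  let v : ℝ → Vec m := fun t => WithLp.toLp 2 (l t ∘ Sum.inr)
  have hu : MemLp u ⊤ (timeMeasure T) :=
    memLp_upsilon_multiplier (Φ := fun x => WithLp.toLp 2 (x ∘ Sum.inl))
      hzb hφ hε hreg hunif hrank hbdd (by fun_prop)
  have hv : MemLp v ⊤ (timeMeasure T) :=
    memLp_upsilon_multiplier (Φ := fun x => WithLp.toLp 2 (x ∘ Sum.inr))
      hzb hφ hε hreg hunif hrank hbdd (by fun_prop)
  have hfirst : ∀ᵐ t ∂timeMeasure T,
        gradient (fun z => φ z t) (zbar t)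
            + ∑ i, u t i • gradient (fun z => h z t i) (zbar t)
            + ∑ j, v t j • gradient (fun z => g z t j) (zbar t) = 0 ∧
        (∀ j, 0 ≤ v t j) ∧ (∀ j, v t j * g (zbar t) t j = 0) := by
    filter_upwards [hmax, hdet, hreg.contDiff, hopt.feasible.eq_zero, hopt.feasible.nonneg,
      ae_restrict_mem measurableSet_Icc] with t h1 h2 h3 h4 h5 ht
    have hnhds := Metric.closedBall_mem_nhds (zbar t) hε
    -- For these slices `slackJacobian` at `zbar t` is `upsilon` by definition, which is what `rfl`
    -- and `h2` rely on.
    exact first_order_condition (H := fun z => h z t) (G := fun z => g z t) (f := fun z => φ z t)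
      (l := l t) ((hφ.contDiff t ht).contDiffAt.differentiableAt two_ne_zero)
      (h3.1.contDiffAt hnhds) (h3.2.contDiffAt hnhds) h4 h5 h2 h1 rfl
  -- The pointwise sign makes the integral meaningful without any bound on the Hessians; it may be
  -- `-∞`.
  refine ⟨u, v, hu, hv, hfirst, fun hcd γ hγ => extIntegral_nonpos
    (aemeasurable_lagrangianHessianForm hzb hφ hε hreg hcd hu.1.aemeasurable hv.1.aemeasurable
      hγ.memLp.1.aemeasurable) ?_⟩
  filter_upwards [hmax, hdet, hcd, hopt.feasible.eq_zero, hopt.feasible.nonneg,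
    ae_restrict_mem measurableSet_Icc, hfirst, hγ.eq_constraints, hγ.active_constraints]
    with t h1 h2 h3 h4 h5 ht h6 h7 h8
  have hnhds := Metric.closedBall_mem_nhds (zbar t) hε
  exact second_order_condition (H := fun z => h z t) (G := fun z => g z t) (f := fun z => φ z t)
    (u := u t) (v := v t) (hφ.contDiff t ht).contDiffAt (h3.1.contDiffAt hnhds)
    (h3.2.contDiffAt hnhds) h4 h5 h2 h1 h6.1 h6.2.2 h7 h8
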